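/- All graphs are finite and simple. A graph is called odd if all of its vertices have odd degree. (i) Every graph on $n$ vertices with no isolated vertices and maximum degree at most $4$ has an odd induced subgraph on at least $2n/7$ vertices. (ii) The bound is sharp: if $c$ is a real number such that every graph on $n$ vertices with no isolated vertices and maximum degree at most $4$, for every $n$, has an odd induced subgraph on at least $cn$ vertices, then $c \le 2/7$. Moreover, for every Hamiltonian cycle $C$ of the complete graph $K_7$, the graph obtained from $K_7$ by deleting the edges of $C$ has no isolated vertices and maximum degree at most $4$, and the maximum number of vertices in an odd induced subgraph of it is exactly $2$ (so its largest odd induced subgraphs are single edges). -/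

import Mathlib

universe u

open Classical in
/-- A finite graph is odd if every vertex has odd degree. -/
def SimpleGraph.IsOdd {V : Type u} [Fintype V] (G : SimpleGraph V) : Prop :=
  ∀ v, Odd (G.degree v)

/-- The vertex set `S` induces an odd subgraph of `G`. The order of that subgraph is `S.card`. -/
def SimpleGraph.InducesOdd {V : Type u} (G : SimpleGraph V) (S : Finset V) : Prop :=
  (G.induce {v | v ∈ S}).IsOdd

/-! The bound comes from a minimal counterexample followed by discharging.

Reduction. In a vertex-minimal counterexample, deleting at most 7j vertices without isolating any
other leaves an odd set that cannot be enlarged by 2j vertices (`IsMinimalCounterexample.reduce`).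
Applied to N(u) ∪ N(v) for an edge uv, corrected so that nothing becomes isolated (`IsRepair`), this
gives |N(u) ∪ N(v)| ≥ 8 (`IsMinimalCounterexample.eight_le`). As degrees are at most 4, the graph is
4-regular and triangle-free.

Discharging. For such graphs an induced forest S with components K₂ and K₁,₃ suffices. Choose S of
maximum order, then with fewest K₁,₃, then with fewest undominated vertices. Local exchanges show
that undominated vertices are independent, and that a private neighbour of S adjacent to one of them
belongs to a K₂-component, which then lies with it on a 5-cycle (`exists_pentagon`). Let D be the
dominated vertices outside S, and W and U the served and unserved undominated ones. Vertices of S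
send charge to D. Each d in D receives at least 1 + |N(d) ∩ U|/4 (`le_sum_contribution`), in total
at least |D| + |U|, because all four neighbours of a vertex of U lie in D. Vertices of S send at
most 5/2 on average, with a further 1/2 held back by serving vertices (`sum_contribution_le`), and
these number at least 2|W|. Hence |D| + |U| + |W| ≤ 5|S|/2, that is, n ≤ 7|S|/2.

Sharpness. K₇ minus a Hamiltonian cycle is the complement of C₇, where all vertex subsets are
checked. -/

open Finset

/-! ### Neighbours inside a set, and odd sets -/

namespace SimpleGraph

variable {V : Type u} {G : SimpleGraph V}

open Classical in
/-- The neighbours of `v` inside `S`. -/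
noncomputable def nbr (G : SimpleGraph V) (S : Finset V) (v : V) : Finset V :=
  S.filter (G.Adj v)

@[simp] lemma mem_nbr {S : Finset V} {v w : V} : w ∈ G.nbr S v ↔ w ∈ S ∧ G.Adj v w := by
  simp [nbr]

lemma nbr_subset (S : Finset V) (v : V) : G.nbr S v ⊆ S := fun _ h => (mem_nbr.1 h).1

lemma nbr_mono {S T : Finset V} (h : S ⊆ T) (v : V) : G.nbr S v ⊆ G.nbr T v :=
  fun _ hw => mem_nbr.2 ⟨h (mem_nbr.1 hw).1, (mem_nbr.1 hw).2⟩

lemma nbr_eq_empty {S : Finset V} {v : V} : G.nbr S v = ∅ ↔ ∀ w ∈ S, ¬ G.Adj v w := by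
  simp [eq_empty_iff_forall_notMem]

lemma card_nbr_singleton_of_adj {v w : V} (h : G.Adj v w) : #(G.nbr {w} v) = 1 := by
  rw [card_eq_one]; exact ⟨w, by ext x; simp; rintro rfl; exact h⟩

/-- All vertices of the subgraph induced by `S` have odd degree. -/
def OddOn (G : SimpleGraph V) (S : Finset V) : Prop := ∀ v ∈ S, Odd #(G.nbr S v)

variable [DecidableEq V]

lemma nbr_union (S T : Finset V) (v : V) : G.nbr (S ∪ T) v = G.nbr S v ∪ G.nbr T v := by
  ext; simp only [mem_nbr, mem_union]; tauto

lemma card_nbr_union {S T : Finset V} (h : Disjoint S T) (v : V) :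
    #(G.nbr (S ∪ T) v) = #(G.nbr S v) + #(G.nbr T v) := by
  rw [nbr_union, card_union_of_disjoint]
  exact h.mono (nbr_subset _ _) (nbr_subset _ _)

lemma OddOn.union {S T : Finset V} (hS : G.OddOn S) (hd : Disjoint S T)
    (hT : ∀ t ∈ T, Odd (#(G.nbr S t) + #(G.nbr T t))) (hST : ∀ s ∈ S, Even #(G.nbr T s)) :
    G.OddOn (S ∪ T) := by
  intro v hv
  rw [card_nbr_union hd]
  rcases mem_union.1 hv with h | h
  · exact (hS v h).add_even (hST v h)
  · exact hT v h

lemma OddOn.union_of_not_adj {S T : Finset V} (hS : G.OddOn S) (hT : G.OddOn T)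
    (hd : Disjoint S T) (hST : ∀ s ∈ S, ∀ t ∈ T, ¬ G.Adj s t) : G.OddOn (S ∪ T) := by
  refine hS.union hd (fun t ht => ?_) (fun s hs => ?_)
  · rw [nbr_eq_empty.2 fun s hs h => hST s hs t ht h.symm]; simpa using hT t ht
  · rw [nbr_eq_empty.2 (hST s hs)]; simp

end SimpleGraph

/-! ### Star forests and the exchange of components -/

namespace SimpleGraph

variable {V : Type u} {G : SimpleGraph V}

/-- Every component of the subgraph induced by `S` is a `K₂` or a `K₁,₃`. -/
def StarForest (G : SimpleGraph V) (S : Finset V) : Prop :=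
  ∀ v ∈ S, #(G.nbr S v) = 1 ∨ #(G.nbr S v) = 3 ∧ ∀ w ∈ G.nbr S v, #(G.nbr S w) = 1

/-- The number of `K₁,₃`-components of a star forest. -/
noncomputable def numStars (G : SimpleGraph V) (S : Finset V) : ℕ :=
  #{v ∈ S | #(G.nbr S v) = 3}

/-- `S` is a star forest with `n` vertices and `k` components `K₁,₃`. -/
structure IsStarForest (G : SimpleGraph V) (S : Finset V) (n k : ℕ) : Prop where
  forest : G.StarForest S
  card : #S = n
  stars : G.numStars S = k

lemma StarForest.oddOn {S : Finset V} (h : G.StarForest S) : G.OddOn S := by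
  intro v hv
  rcases h v hv with h | h
  · rw [h]; decide
  · rw [h.1]; decide

lemma StarForest.isStarForest {S : Finset V} (h : G.StarForest S) :
    G.IsStarForest S #S (G.numStars S) := ⟨h, rfl, rfl⟩

variable [DecidableEq V]

lemma IsStarForest.union {A B : Finset V} {n m k l : ℕ} (hA : G.IsStarForest A n k)
    (hB : G.IsStarForest B m l) (h : ∀ a ∈ A, ∀ b ∈ B, a ≠ b ∧ ¬ G.Adj a b) :
    G.IsStarForest (A ∪ B) (n + m) (k + l) := by
  have hd : Disjoint A B := by
    rw [Finset.disjoint_left]; intro a ha hb; exact (h a ha a hb).1 rfl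
  have h1 : ∀ a ∈ A, G.nbr (A ∪ B) a = G.nbr A a := fun a ha => by
    rw [nbr_union, nbr_eq_empty.2 fun b hb => (h a ha b hb).2, union_empty]
  have h2 : ∀ b ∈ B, G.nbr (A ∪ B) b = G.nbr B b := fun b hb => by
    rw [nbr_union, nbr_eq_empty.2 fun a ha hab => (h a ha b hb).2 hab.symm, empty_union]
  refine ⟨?_, by rw [card_union_of_disjoint hd, hA.card, hB.card], ?_⟩
  · intro v hv
    rcases mem_union.1 hv with hv | hv
    · rw [h1 v hv]
      refine (hA.forest v hv).imp id fun h3 => ⟨h3.1, fun w hw => ?_⟩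
      rw [h1 w (mem_nbr.1 hw).1]; exact h3.2 w hw
    · rw [h2 v hv]
      refine (hB.forest v hv).imp id fun h3 => ⟨h3.1, fun w hw => ?_⟩
      rw [h2 w (mem_nbr.1 hw).1]; exact h3.2 w hw
  · rw [← hA.stars, ← hB.stars, numStars, numStars, numStars, filter_union,
      card_union_of_disjoint (disjoint_filter_filter hd)]
    congr 2
    · exact filter_congr fun a ha => by rw [h1 a ha]
    · exact filter_congr fun a ha => by rw [h2 a ha]

lemma StarForest.of_union {A B : Finset V} (hf : G.StarForest (A ∪ B))
    (h : ∀ a ∈ A, ∀ b ∈ B, a ≠ b ∧ ¬ G.Adj a b) : G.StarForest A := by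
  have h1 : ∀ a ∈ A, G.nbr (A ∪ B) a = G.nbr A a := fun a ha => by
    rw [nbr_union, nbr_eq_empty.2 fun b hb => (h a ha b hb).2, union_empty]
  intro v hv
  rw [← h1 v hv]
  refine (hf v (mem_union_left _ hv)).imp id fun h3 => ⟨h3.1, fun w hw => ?_⟩
  rw [h1 v hv] at hw
  rw [← h1 w (mem_nbr.1 hw).1]
  exact h3.2 w (by rw [h1 v hv]; exact hw)

lemma isStarForest_pair {p q : V} (h : G.Adj p q) : G.IsStarForest {p, q} 2 0 := by
  have h1 : G.nbr {p, q} p = {q} := by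
    ext x; simp only [mem_nbr, mem_insert, mem_singleton]
    constructor
    · rintro ⟨rfl | rfl, h'⟩
      · exact absurd h' (G.irrefl)
      · rfl
    · rintro rfl; exact ⟨Or.inr rfl, h⟩
  have h2 : G.nbr {p, q} q = {p} := by
    ext x; simp only [mem_nbr, mem_insert, mem_singleton]
    constructor
    · rintro ⟨rfl | rfl, h'⟩
      · rfl
      · exact absurd h' (G.irrefl)
    · rintro rfl; exact ⟨Or.inl rfl, h.symm⟩
  refine ⟨?_, card_pair h.ne, ?_⟩
  · simp [StarForest, h1, h2]
  · simp [numStars, h1, h2, filter_insert, filter_singleton]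

lemma isStarForest_star {c a b e : V} (ha : G.Adj c a) (hb : G.Adj c b) (he : G.Adj c e)
    (hab : a ≠ b ∧ ¬ G.Adj a b) (hae : a ≠ e ∧ ¬ G.Adj a e) (hbe : b ≠ e ∧ ¬ G.Adj b e) :
    G.IsStarForest {c, a, b, e} 4 1 := by
  have hs : ∀ x y, G.Adj x y → G.Adj y x := fun x y h => h.symm
  have hi : ∀ x, ¬ G.Adj x x := fun x => G.irrefl
  have hc : G.nbr {c, a, b, e} c = {a, b, e} := by
    ext x; simp only [mem_nbr, mem_insert, mem_singleton]; grind
  have h1 : G.nbr {c, a, b, e} a = {c} := by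
    ext x; simp only [mem_nbr, mem_insert, mem_singleton]; grind
  have h2 : G.nbr {c, a, b, e} b = {c} := by
    ext x; simp only [mem_nbr, mem_insert, mem_singleton]; grind
  have h3 : G.nbr {c, a, b, e} e = {c} := by
    ext x; simp only [mem_nbr, mem_insert, mem_singleton]; grind
  have h4 : #{a, b, e} = 3 := card_eq_three.2 ⟨a, b, e, hab.1, hae.1, hbe.1, rfl⟩
  refine ⟨?_, ?_, ?_⟩
  · simp only [StarForest, mem_insert, mem_singleton, forall_eq_or_imp, forall_eq, hc, h1, h2, h3,
      h4, card_singleton]; simp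
  · rw [card_insert_of_notMem, h4]
    simp only [mem_insert, mem_singleton]; grind
  · simp [numStars, h1, h2, h3, hc, h4, filter_insert, filter_singleton]

/-- Replacing some components `R` of a star forest by a star forest `T`. -/
lemma StarForest.exchange {S R T : Finset V} {n m k l : ℕ} (hS : G.StarForest S) (hRS : R ⊆ S)
    (hR : ∀ r ∈ R, ∀ s ∈ S, G.Adj r s → s ∈ R) (hRf : G.IsStarForest R n k)
    (hT : G.IsStarForest T m l) (h : ∀ s ∈ S, s ∉ R → ∀ t ∈ T, s ≠ t ∧ ¬ G.Adj s t) :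
    G.StarForest (S \ R ∪ T) ∧ #(S \ R ∪ T) + n = #S + m ∧
      G.numStars (S \ R ∪ T) + k = G.numStars S + l := by
  have hA : ∀ a ∈ S \ R, ∀ b ∈ R, a ≠ b ∧ ¬ G.Adj a b := by
    intro a ha b hb
    rw [mem_sdiff] at ha
    exact ⟨fun e => ha.2 (e ▸ hb), fun hab => ha.2 (hR b hb a ha.1 hab.symm)⟩
  have hSR : S \ R ∪ R = S := sdiff_union_of_subset hRS
  have h1 : G.StarForest (S \ R) := StarForest.of_union (B := R) (by rwa [hSR]) hA
  have h2 := h1.isStarForest.union hRf hA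
  rw [hSR] at h2
  have h3 := h1.isStarForest.union hT fun s hs t ht =>
    h s (mem_sdiff.1 hs).1 (mem_sdiff.1 hs).2 t ht
  refine ⟨h3.forest, ?_, ?_⟩
  · rw [h3.card, h2.card]; omega
  · rw [h3.stars, h2.stars]; omega

end SimpleGraph

/-! ### Optimal star forests; private neighbours of K₁,₃-components -/

namespace SimpleGraph

variable {V : Type u} {G : SimpleGraph V}

/-- `x` lies outside `S` and has no neighbour in `S`. -/
def Undominated (G : SimpleGraph V) (S : Finset V) (x : V) : Prop :=
  x ∉ S ∧ ∀ w ∈ S, ¬ G.Adj x w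

/-- `d` lies outside `S` and `s` is its only neighbour in `S`. -/
def IsPrivate (G : SimpleGraph V) (S : Finset V) (d s : V) : Prop :=
  d ∉ S ∧ s ∈ S ∧ ∀ w ∈ S, G.Adj d w ↔ w = s

/-- `{s, t}` is a `K₂`-component of the subgraph induced by `S`. -/
def IsEdgeComponent (G : SimpleGraph V) (S : Finset V) (s t : V) : Prop :=
  s ∈ S ∧ t ∈ S ∧ (∀ w ∈ S, G.Adj s w ↔ w = t) ∧ ∀ w ∈ S, G.Adj t w ↔ w = s

/-- `{c, a, b, e}` is a `K₁,₃`-component, with centre `c`, of the subgraph induced by `S`. -/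
def IsStarComponent (G : SimpleGraph V) (S : Finset V) (c a b e : V) : Prop :=
  (c ∈ S ∧ a ∈ S ∧ b ∈ S ∧ e ∈ S) ∧ (a ≠ b ∧ a ≠ e ∧ b ≠ e) ∧
  (∀ w ∈ S, G.Adj c w ↔ w = a ∨ w = b ∨ w = e) ∧ (∀ w ∈ S, G.Adj a w ↔ w = c) ∧
  (∀ w ∈ S, G.Adj b w ↔ w = c) ∧ ∀ w ∈ S, G.Adj e w ↔ w = c

open Classical in
/-- A star forest that has the largest possible order, subject to this the fewest components
`K₁,₃`, and subject to this the fewest undominated vertices. -/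
structure IsOptimal [Fintype V] (G : SimpleGraph V) (S : Finset V) : Prop where
  forest : G.StarForest S
  card_le : ∀ T, G.StarForest T → #T ≤ #S
  stars_le : ∀ T, G.StarForest T → #T = #S → G.numStars S ≤ G.numStars T
  undominated_le : ∀ T, G.StarForest T → #T = #S → G.numStars T = G.numStars S →
    #{x | G.Undominated S x} ≤ #{x | G.Undominated T x}

open Classical in
lemma exists_isOptimal [Fintype V] (G : SimpleGraph V) : ∃ S, G.IsOptimal S := by
  have h0 : ({S | G.StarForest S} : Finset (Finset V)).Nonempty := ⟨∅, by simp [StarForest]⟩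
  obtain ⟨A, hA, hA'⟩ := exists_max_image _ (fun S : Finset V => #S) h0
  have h1 : ({S | G.StarForest S ∧ #S = #A} : Finset (Finset V)).Nonempty :=
    ⟨A, by simpa using hA⟩
  obtain ⟨B, hB, hB'⟩ := exists_min_image _ (fun S : Finset V => G.numStars S) h1
  have h2 : ({S | G.StarForest S ∧ #S = #A ∧ G.numStars S = G.numStars B} :
      Finset (Finset V)).Nonempty := ⟨B, by simpa using hB⟩
  obtain ⟨C, hC, hC'⟩ := exists_min_image _ (fun S : Finset V => #{x | G.Undominated S x}) h2
  simp only [mem_filter, mem_univ, true_and] at hA hA' hB hB' hC hC'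
  exact ⟨C, hC.1, fun T hT => hC.2.1 ▸ hA' T hT,
    fun T hT h => hC.2.2 ▸ hB' T ⟨hT, h.trans hC.2.1⟩,
    fun T hT h h' => hC' T ⟨hT, h.trans hC.2.1, h'.trans hC.2.2⟩⟩

lemma IsEdgeComponent.symm {S : Finset V} {s t : V} (h : G.IsEdgeComponent S s t) :
    G.IsEdgeComponent S t s := ⟨h.2.1, h.1, h.2.2.2, h.2.2.1⟩

lemma IsEdgeComponent.adj {S : Finset V} {s t : V} (h : G.IsEdgeComponent S s t) : G.Adj s t :=
  (h.2.2.1 t h.2.1).2 rfl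

namespace IsOptimal

variable [Fintype V] [DecidableEq V] {S : Finset V}

/-- The first two optimality criteria as an exchange rule: `R` is a union of components of `S`, and
trading it for `T` can neither raise the order nor keep it with fewer stars. -/
lemma not_gain (hS : G.IsOptimal S) {R T : Finset V} {n m k l : ℕ} (hRS : R ⊆ S)
    (hR : ∀ r ∈ R, ∀ s ∈ S, G.Adj r s → s ∈ R) (hRf : G.IsStarForest R n k)
    (hT : G.IsStarForest T m l) (h : ∀ s ∈ S, s ∉ R → ∀ t ∈ T, s ≠ t ∧ ¬ G.Adj s t) :
    m < n ∨ m = n ∧ k ≤ l := by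
  obtain ⟨h1, h2, h3⟩ := hS.forest.exchange hRS hR hRf hT h
  have h4 := hS.card_le _ h1
  by_cases h5 : m = n
  · have := hS.stars_le _ h1 (by omega); omega
  · omega

/-- The third criterion: a trade that keeps order and star count and dominates `x` must make some
other vertex newly undominated. -/
lemma exists_undominated (hS : G.IsOptimal S) {R T : Finset V} {n k : ℕ} (hRS : R ⊆ S)
    (hR : ∀ r ∈ R, ∀ s ∈ S, G.Adj r s → s ∈ R) (hRf : G.IsStarForest R n k)
    (hT : G.IsStarForest T n k) (h : ∀ s ∈ S, s ∉ R → ∀ t ∈ T, s ≠ t ∧ ¬ G.Adj s t)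
    {x t : V} (hx : G.Undominated S x) (ht : t ∈ T) (hxt : G.Adj x t) :
    ∃ y, G.Undominated (S \ R ∪ T) y ∧ ¬ G.Undominated S y := by
  classical
  obtain ⟨h1, h2, h3⟩ := hS.forest.exchange hRS hR hRf hT h
  by_contra! hc
  have h4 := hS.undominated_le _ h1 (by omega) (by omega)
  have h5 : #{x | G.Undominated (S \ R ∪ T) x} < #{x | G.Undominated S x} := by
    refine card_lt_card (ssubset_iff_of_subset ?_ |>.2 ⟨x, by simpa using hx, ?_⟩)
    · intro y hy
      simp only [mem_filter, mem_univ, true_and] at hy ⊢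
      exact hc y hy
    · simp only [mem_filter, mem_univ, true_and]
      exact fun h => h.2 t (mem_union_right _ ht) hxt
  omega

/-- Undominated vertices are pairwise nonadjacent. -/
lemma not_adj_of_undominated (hS : G.IsOptimal S) {x y : V} (hx : G.Undominated S x)
    (hy : G.Undominated S y) : ¬ G.Adj x y := by
  intro hxy
  have hs := G.symm
  have := hS.not_gain (R := ∅) (n := 0) (k := 0) (empty_subset S) (by simp)
    ⟨by simp [StarForest], rfl, rfl⟩ (isStarForest_pair hxy) (by
      simp only [Undominated] at *
      simp only [mem_insert, mem_singleton]
      grind [SimpleGraph.adj_comm])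
  omega

/-- A private neighbour of a leaf of a star has no undominated neighbour. -/
lemma not_adj_of_private_leaf (hS : G.IsOptimal S) {c a b e d x : V}
    (hc : G.IsStarComponent S c a b e) (hd : G.IsPrivate S d a) (hx : G.Undominated S x) :
    ¬ G.Adj d x := by
  intro hdx
  obtain ⟨⟨hc1, ha1, hb1, he1⟩, ⟨hab, hae, hbe⟩, hc2, ha2, hb2, he2⟩ := hc
  have hcomm := G.adj_comm
  have hi : ∀ x, ¬ G.Adj x x := fun x => G.irrefl
  simp only [Undominated, IsPrivate] at *
  -- The edges cb and dx replace the star: same order, one star fewer.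
  have := hS.not_gain (R := {c, a, b, e}) (T := {c, b} ∪ {d, x})
    (by simp [insert_subset_iff, *]) (by simp only [mem_insert, mem_singleton]; grind)
    (isStarForest_star (by grind) (by grind) (by grind) (by grind) (by grind) (by grind))
    ((isStarForest_pair (by grind)).union (isStarForest_pair hdx)
      (by simp only [mem_insert, mem_singleton]; grind))
    (by simp only [mem_insert, mem_singleton, mem_union]; grind)
  omega

/-- A private neighbour of the centre of a star has no undominated neighbour. -/
lemma not_adj_of_private_center (hS : G.IsOptimal S) {c a b e d x : V}
    (hc : G.IsStarComponent S c a b e) (hd : G.IsPrivate S d c) (hx : G.Undominated S x) :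
    ¬ G.Adj d x := by
  intro hdx
  have hleaf : ∀ y, G.IsPrivate S y a → ¬ G.Adj y x :=
    fun y hy => hS.not_adj_of_private_leaf hc hy hx
  have hcomm := G.adj_comm
  have hi : ∀ x, ¬ G.Adj x x := fun x => G.irrefl
  have hx' := hx
  obtain ⟨⟨hc1, ha1, hb1, he1⟩, ⟨hab, hae, hbe⟩, hc2, ha2, hb2, he2⟩ := hc
  have hR : ∀ r ∈ ({c, a, b, e} : Finset V), ∀ s ∈ S, G.Adj r s →
      s ∈ ({c, a, b, e} : Finset V) := by
    simp only [mem_insert, mem_singleton]; grind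
  have hRS : ({c, a, b, e} : Finset V) ⊆ S := by simp [insert_subset_iff, *]
  have hRf : G.IsStarForest {c, a, b, e} 4 1 :=
    isStarForest_star (by grind) (by grind) (by grind) (by grind) (by grind) (by grind)
  simp only [IsPrivate] at hd hleaf
  simp only [Undominated] at hx
  -- If such a y exists, the edges ay and dx replace the star; y misses x by the leaf case.
  -- Otherwise the leaf a is traded for d: only private neighbours of a could lose domination, and
  -- all of them are adjacent to d.
  by_cases h : ∃ y, G.IsPrivate S y a ∧ ¬ G.Adj y d
  · obtain ⟨y, hy, hyd⟩ := h
    simp only [IsPrivate] at hy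
    have := hS.not_gain (T := {a, y} ∪ {d, x}) hRS hR hRf
      ((isStarForest_pair (by grind)).union (isStarForest_pair hdx)
        (by simp only [mem_insert, mem_singleton]; grind))
      (by simp only [mem_insert, mem_singleton, mem_union]; grind)
    omega
  · push Not at h
    obtain ⟨y, hy, hy'⟩ := hS.exists_undominated (T := {c, d, b, e}) hRS hR hRf
      (isStarForest_star (by grind) (by grind) (by grind) (by grind) (by grind) (by grind))
      (by simp only [mem_insert, mem_singleton]; grind) hx' (t := d) (by simp) hdx.symm
    simp only [Undominated, mem_union, mem_sdiff, mem_insert, mem_singleton, IsPrivate] at *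
    grind

end IsOptimal

end SimpleGraph

/-! ### K₂-components that serve undominated vertices -/

namespace SimpleGraph

variable {V : Type u} {G : SimpleGraph V}

/-- An end of a `K₂`-component that has a private neighbour with an undominated neighbour `x`. -/
def Serves (G : SimpleGraph V) (S : Finset V) (s x : V) : Prop :=
  G.Undominated S x ∧ (∃ t, G.IsEdgeComponent S s t) ∧ ∃ d, G.IsPrivate S d s ∧ G.Adj d x

namespace IsOptimal

variable [Fintype V] [DecidableEq V] {S : Finset V}

/-- Otherwise t, d, d' are the leaves of an induced claw at s, and replacing st by it gains two
vertices. -/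
lemma private_unique (hfree : ∀ a b c, G.Adj a b → G.Adj b c → ¬ G.Adj a c)
    (hS : G.IsOptimal S) {s t d d' : V} (he : G.IsEdgeComponent S s t)
    (hd : G.IsPrivate S d s) (hd' : G.IsPrivate S d' s) : d = d' := by
  by_contra hne
  have hcomm := G.adj_comm
  have hi : ∀ x, ¬ G.Adj x x := fun x => G.irrefl
  have hst := he.adj
  simp only [IsEdgeComponent, IsPrivate] at *
  have := hS.not_gain (R := {s, t}) (T := {s, t, d, d'})
    (by simp [insert_subset_iff, *]) (by simp only [mem_insert, mem_singleton]; grind)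
    (isStarForest_pair hst)
    (isStarForest_star (by grind) (by grind) (by grind) (by grind) (by grind) (by grind))
    (by simp only [mem_insert, mem_singleton]; grind)
  omega

/-- Otherwise the induced claw at d with leaves s, x, x' replaces st. -/
lemma undominated_unique (hfree : ∀ a b c, G.Adj a b → G.Adj b c → ¬ G.Adj a c)
    (hS : G.IsOptimal S) {s t d x x' : V} (he : G.IsEdgeComponent S s t)
    (hd : G.IsPrivate S d s) (hx : G.Undominated S x) (hx' : G.Undominated S x')
    (hdx : G.Adj d x) (hdx' : G.Adj d x') : x = x' := by
  by_contra hne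
  have hcomm := G.adj_comm
  have hi : ∀ x, ¬ G.Adj x x := fun x => G.irrefl
  have hst := he.adj
  simp only [IsEdgeComponent, IsPrivate, Undominated] at *
  have := hS.not_gain (R := {s, t}) (T := {d, s, x, x'})
    (by simp [insert_subset_iff, *]) (by simp only [mem_insert, mem_singleton]; grind)
    (isStarForest_pair hst)
    (isStarForest_star (by grind) (by grind) (by grind) (by grind) (by grind) (by grind))
    (by simp only [mem_insert, mem_singleton]; grind)
  omega

/-- If a private neighbour y of t missed both d and x, the edges ty and dx would replace st. If
every private neighbour of t were adjacent to d, trading t for d would dominate x and undominate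
nothing. -/
lemma exists_opposite_private (hfree : ∀ a b c, G.Adj a b → G.Adj b c → ¬ G.Adj a c)
    (hS : G.IsOptimal S) {s t d x : V} (he : G.IsEdgeComponent S s t)
    (hd : G.IsPrivate S d s) (hx : G.Undominated S x) (hdx : G.Adj d x) :
    ∃ y, G.IsPrivate S y t ∧ ¬ G.Adj y d ∧ G.Adj y x := by
  have hcomm := G.adj_comm
  have hi : ∀ x, ¬ G.Adj x x := fun x => G.irrefl
  have hst := he.adj
  have hx' := hx
  have hR : ∀ r ∈ ({s, t} : Finset V), ∀ w ∈ S, G.Adj r w → w ∈ ({s, t} : Finset V) := by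
    simp only [IsEdgeComponent] at he
    simp only [mem_insert, mem_singleton]; grind
  have hRS : ({s, t} : Finset V) ⊆ S := by
    simp only [IsEdgeComponent] at he
    simp [insert_subset_iff, *]
  by_cases h : ∃ y, G.IsPrivate S y t ∧ ¬ G.Adj y d
  · obtain ⟨y, hy, hyd⟩ := h
    refine ⟨y, hy, hyd, ?_⟩
    by_contra hyx
    simp only [IsPrivate, Undominated, IsEdgeComponent] at *
    have := hS.not_gain (T := {t, y} ∪ {d, x}) hRS hR (isStarForest_pair hst)
      ((isStarForest_pair (by grind)).union (isStarForest_pair hdx)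
        (by simp only [mem_insert, mem_singleton]; grind))
      (by simp only [mem_insert, mem_singleton, mem_union]; grind)
    omega
  · push Not at h
    simp only [IsPrivate, Undominated, IsEdgeComponent] at hd he hx h
    obtain ⟨y, hy, hy'⟩ := hS.exists_undominated (T := {s, d}) hRS hR (isStarForest_pair hst)
      (isStarForest_pair (by grind))
      (by simp only [mem_insert, mem_singleton]; grind) hx' (t := d) (by simp) hdx.symm
    simp only [Undominated, mem_union, mem_sdiff, mem_insert, mem_singleton, IsPrivate] at *
    grind

/-- The structure of a `K₂`-component that serves an undominated vertex: an induced 5-cycle. -/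
lemma exists_pentagon (hfree : ∀ a b c, G.Adj a b → G.Adj b c → ¬ G.Adj a c)
    (hS : G.IsOptimal S) {s x : V} (h : G.Serves S s x) :
    ∃ t a y, G.IsEdgeComponent S s t ∧ G.IsPrivate S a s ∧ G.IsPrivate S y t ∧
      G.Undominated S x ∧ G.Adj a x ∧ G.Adj y x ∧ ¬ G.Adj a y := by
  obtain ⟨hx, ⟨t, he⟩, d, hd, hdx⟩ := h
  obtain ⟨y, hy, hyd, hyx⟩ := hS.exists_opposite_private hfree he hd hx hdx
  exact ⟨t, d, y, he, hd, hy, hx, hdx, hyx, fun h => hyd h.symm⟩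

lemma Serves_unique (hfree : ∀ a b c, G.Adj a b → G.Adj b c → ¬ G.Adj a c)
    (hS : G.IsOptimal S) {s x x' : V} (h : G.Serves S s x) (h' : G.Serves S s x') : x = x' := by
  obtain ⟨hx, ⟨t, he⟩, d, hd, hdx⟩ := h
  obtain ⟨hx', ⟨t', he'⟩, d', hd', hdx'⟩ := h'
  obtain rfl := hS.private_unique hfree he hd hd'
  exact hS.undominated_unique hfree he hd hx hx' hdx hdx'

/-- The two K₂-components are traded for the pentagon edge t₁y and the claw at d with leaves s₂, x,
x', six vertices for four. The vertex y misses x and x' because these are unserved. -/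
lemma not_two_unserved (hfree : ∀ a b c, G.Adj a b → G.Adj b c → ¬ G.Adj a c)
    (hS : G.IsOptimal S) {s₁ s₂ t₂ z d x x' : V} (h₁ : G.Serves S s₁ z)
    (he : G.IsEdgeComponent S s₂ t₂) (hne : s₁ ≠ s₂) (hd : d ∉ S)
    (hN : ∀ w, G.Adj d w ↔ w = s₁ ∨ w = s₂ ∨ w = x ∨ w = x') (hxx : x ≠ x')
    (hx : G.Undominated S x) (hx' : G.Undominated S x')
    (hsx : ∀ s, ¬ G.Serves S s x) (hsx' : ∀ s, ¬ G.Serves S s x') : False := by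
  obtain ⟨t₁, a, y, he₁, ha, hy, hz, haz, hyz, hay⟩ := hS.exists_pentagon hfree h₁
  have hyx : ¬ G.Adj y x := fun h => hsx t₁ ⟨hx, ⟨s₁, he₁.symm⟩, y, hy, h⟩
  have hyx' : ¬ G.Adj y x' := fun h => hsx' t₁ ⟨hx', ⟨s₁, he₁.symm⟩, y, hy, h⟩
  have hcomm := G.adj_comm
  have hi : ∀ x, ¬ G.Adj x x := fun x => G.irrefl
  have hst := he.adj
  have hst₁ := he₁.adj
  have h12 : s₁ ≠ t₂ := by
    rintro rfl; exact hfree s₂ s₁ d hst ((hN s₁).2 (by simp)).symm ((hN s₂).2 (by simp)).symm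
  have hxx' := hS.not_adj_of_undominated hx hx'
  have hne1 : y ≠ x := by rintro rfl; exact hx.2 t₁ hy.2.1 ((hy.2.2 t₁ hy.2.1).2 rfl)
  have hne2 : y ≠ x' := by rintro rfl; exact hx'.2 t₁ hy.2.1 ((hy.2.2 t₁ hy.2.1).2 rfl)
  have hdy : ¬ G.Adj d y := by
    intro h
    rcases (hN y).1 h with rfl | rfl | h | h
    exacts [hy.1 he₁.1, hy.1 he.1, hne1 h, hne2 h]
  clear hsx hsx' h₁ hfree
  simp only [IsPrivate, Undominated, IsEdgeComponent] at *
  have := hS.not_gain (R := {s₁, t₁} ∪ {s₂, t₂}) (T := {t₁, y} ∪ {d, s₂, x, x'})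
    (by simp [insert_subset_iff, *])
    (by simp only [mem_insert, mem_singleton, mem_union]; grind)
    ((isStarForest_pair hst₁).union (isStarForest_pair hst)
        (by simp only [mem_insert, mem_singleton]; grind))
    ((isStarForest_pair (by grind)).union
      (isStarForest_star (by grind) (by grind) (by grind) (by grind) (by grind) (by grind))
        (by simp only [mem_insert, mem_singleton]; grind))
    (by simp only [mem_insert, mem_singleton, mem_union]; grind)
  omega

/-- `T` together with the edge dx would replace two K₂-components, six vertices for four. -/
lemma false_of_free_four (hS : G.IsOptimal S) {s₁ t₁ s₂ t₂ d x : V}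
    (he₁ : G.IsEdgeComponent S s₁ t₁) (he₂ : G.IsEdgeComponent S s₂ t₂)
    (hne : s₁ ≠ s₂) (hne' : s₁ ≠ t₂) (hd : d ∉ S)
    (hN : ∀ w ∈ S, G.Adj d w → w = s₁ ∨ w = s₂) (hx : G.Undominated S x) (hdx : G.Adj d x)
    {T : Finset V} {k : ℕ} (hT : G.IsStarForest T 4 k)
    (hT' : ∀ w ∈ T, (w ≠ d ∧ w ≠ x ∧ ¬ G.Adj d w ∧ ¬ G.Adj x w) ∧
      ∀ s ∈ S, s = w ∨ G.Adj w s → s = s₁ ∨ s = t₁ ∨ s = s₂ ∨ s = t₂) : False := by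
  have hcomm := G.adj_comm
  have hst := he₁.adj
  have hst₂ := he₂.adj
  simp only [Undominated, IsEdgeComponent] at *
  have := hS.not_gain (R := {s₁, t₁} ∪ {s₂, t₂}) (T := T ∪ {d, x})
    (by simp [insert_subset_iff, *])
    (by simp only [mem_insert, mem_singleton, mem_union]; grind)
    ((isStarForest_pair hst).union (isStarForest_pair hst₂)
        (by simp only [mem_insert, mem_singleton]; grind))
    (hT.union (isStarForest_pair hdx)
        (by simp only [mem_insert, mem_singleton]; grind))
    (by simp only [mem_insert, mem_singleton, mem_union]; grind)
  omega

/-- A suitable four-vertex `T` for `false_of_free_four` is found in the two pentagons. The last two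
hypotheses keep d away from the second pentagon, except at s₂ and possibly at a shared z; d may
still meet the first one at y₁ or z₁. -/
lemma false_of_two_pentagons (hfree : ∀ a b c, G.Adj a b → G.Adj b c → ¬ G.Adj a c)
    (hS : G.IsOptimal S) {s₁ t₁ a₁ y₁ z₁ s₂ t₂ a₂ y₂ z₂ d x : V}
    (he₁ : G.IsEdgeComponent S s₁ t₁) (ha₁ : G.IsPrivate S a₁ s₁) (hy₁ : G.IsPrivate S y₁ t₁)
    (hz₁ : G.Undominated S z₁) (haz₁ : G.Adj a₁ z₁) (hyz₁ : G.Adj y₁ z₁)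
    (he₂ : G.IsEdgeComponent S s₂ t₂) (ha₂ : G.IsPrivate S a₂ s₂) (hy₂ : G.IsPrivate S y₂ t₂)
    (hz₂ : G.Undominated S z₂) (haz₂ : G.Adj a₂ z₂) (hyz₂ : G.Adj y₂ z₂) (hay₂ : ¬ G.Adj a₂ y₂)
    (hne : s₁ ≠ s₂) (hd : d ∉ S) (hds₁ : G.Adj d s₁) (hds₂ : G.Adj d s₂)
    (hN : ∀ w ∈ S, G.Adj d w → w = s₁ ∨ w = s₂)
    (hx : G.Undominated S x) (hsx : ∀ s, ¬ G.Serves S s x) (hdx : G.Adj d x)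
    (hdy₂ : ¬ G.Adj d y₂) (hdz₂ : z₁ ≠ z₂ → ¬ G.Adj d z₂) : False := by
  have hst₁ := he₁.adj
  have hst₂ := he₂.adj
  have h12 : s₁ ≠ t₂ := by rintro rfl; exact hfree _ _ _ hst₂ hds₁.symm hds₂.symm
  have h21 : s₂ ≠ t₁ := by rintro rfl; exact hfree _ _ _ hst₁ hds₂.symm hds₁.symm
  have h22 : t₁ ≠ t₂ := by
    rintro rfl
    exact hne ((he₁.2.2.2 s₂ he₂.1).1 hst₂.symm).symm
  -- The vertices that `T` may use.
  let P : V → Prop := fun w => (w ≠ d ∧ w ≠ x ∧ ¬ G.Adj d w ∧ ¬ G.Adj x w) ∧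
      ∀ s ∈ S, s = w ∨ G.Adj w s → s = s₁ ∨ s = t₁ ∨ s = s₂ ∨ s = t₂
  have key : ∀ {T : Finset V} {k : ℕ}, G.IsStarForest T 4 k → (∀ w ∈ T, P w) → False :=
    fun hT hT' => hS.false_of_free_four he₁ he₂ hne h12 hd hN hx hdx hT hT'
  have hPt₁ : P t₁ := by
    refine ⟨⟨?_, ?_, ?_, ?_⟩, ?_⟩
    · rintro rfl; exact hd he₁.2.1
    · rintro rfl; exact hx.1 he₁.2.1
    · exact fun h => hfree _ _ _ hds₁ hst₁ h
    · exact hx.2 _ he₁.2.1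
    · rintro s hs (rfl | h)
      · simp
      · exact Or.inl ((he₁.2.2.2 s hs).1 h)
  have hPt₂ : P t₂ := by
    refine ⟨⟨?_, ?_, ?_, ?_⟩, ?_⟩
    · rintro rfl; exact hd he₂.2.1
    · rintro rfl; exact hx.1 he₂.2.1
    · exact fun h => hfree _ _ _ hds₂ hst₂ h
    · exact hx.2 _ he₂.2.1
    · rintro s hs (rfl | h)
      · simp
      · exact Or.inr (Or.inr (Or.inl ((he₂.2.2.2 s hs).1 h)))
  have hpriv : ∀ {p s t : V}, G.IsEdgeComponent S s t → G.IsPrivate S p s → ¬ G.Adj d p →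
      (s = s₁ ∨ s = t₁ ∨ s = s₂ ∨ s = t₂) → P p := by
    intro p s t he hp hdp hs
    have hsd : G.Adj p s := (hp.2.2 s hp.2.1).2 rfl
    refine ⟨⟨?_, ?_, hdp, ?_⟩, ?_⟩
    · rintro rfl
      exact hne (((hp.2.2 s₁ he₁.1).1 hds₁).trans ((hp.2.2 s₂ he₂.1).1 hds₂).symm)
    · rintro rfl; exact hx.2 s hp.2.1 hsd
    · exact fun h => hsx s ⟨hx, ⟨t, he⟩, p, hp, h.symm⟩
    · rintro w hw (rfl | h)
      · exact absurd hw hp.1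
      · rw [(hp.2.2 w hw).1 h]; exact hs
  have hPa₁ : P a₁ := hpriv he₁ ha₁
    (fun h => hfree _ _ _ hds₁ ((ha₁.2.2 _ ha₁.2.1).2 rfl).symm h) (by simp)
  have hPa₂ : P a₂ := hpriv he₂ ha₂
    (fun h => hfree _ _ _ hds₂ ((ha₂.2.2 _ ha₂.2.1).2 rfl).symm h) (by simp)
  have hPy₁ : ¬ G.Adj d y₁ → P y₁ := fun h => hpriv he₁.symm hy₁ h (by simp)
  have hPy₂ : P y₂ := hpriv he₂.symm hy₂ hdy₂ (by simp)
  have hPz : ∀ {z p s t : V}, G.IsEdgeComponent S s t → G.IsPrivate S p s → G.Adj p z →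
      G.Undominated S z → ¬ G.Adj d z → P z := by
    intro z p s t he hp hpz hz hdz
    refine ⟨⟨?_, ?_, hdz, hS.not_adj_of_undominated hx hz⟩, ?_⟩
    · rintro rfl; exact hz.2 _ he₁.1 hds₁
    · rintro rfl; exact hsx s ⟨hx, ⟨t, he⟩, p, hp, hpz⟩
    · rintro w hw (rfl | h)
      · exact absurd hw hz.1
      · exact absurd h (hz.2 w hw)
  have hPz₁ : ¬ G.Adj d z₁ → P z₁ := hPz he₁ ha₁ haz₁ hz₁
  have hPz₂ : ¬ G.Adj d z₂ → P z₂ := hPz he₂ ha₂ haz₂ hz₂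
  have htr₁ := hfree d y₁ z₁
  have hcomm := G.adj_comm
  have hty₁ : G.Adj t₁ y₁ := ((hy₁.2.2 _ hy₁.2.1).2 rfl).symm
  have hty₂ : G.Adj t₂ y₂ := ((hy₂.2.2 _ hy₂.2.1).2 rfl).symm
  have huniq : ∀ {p s t z z' : V}, G.IsEdgeComponent S s t → G.IsPrivate S p s →
      G.Undominated S z → G.Undominated S z' → G.Adj p z → z ≠ z' → p ≠ z' ∧ ¬ G.Adj p z' := by
    intro p s t z z' he hp hz hz' hpz hzz
    refine ⟨?_, fun h => hzz (hS.undominated_unique hfree he hp hz hz' hpz h)⟩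
    rintro rfl; exact hz'.2 s hp.2.1 ((hp.2.2 _ hp.2.1).2 rfl)
  have hpp : ∀ {p s q r : V}, G.IsPrivate S p s → G.IsPrivate S q r → s ≠ r → p ≠ q := by
    rintro p s q r hp hq hsr rfl
    exact hsr ((hq.2.2 s hp.2.1).1 ((hp.2.2 s hp.2.1).2 rfl))
  have htp : ∀ {t p s : V}, t ∈ S → G.IsPrivate S p s → t ≠ s → t ≠ p ∧ ¬ G.Adj t p := by
    intro t p s ht hp hts
    exact ⟨fun h => hp.1 (h ▸ ht), fun h => hts ((hp.2.2 t ht).1 h.symm)⟩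
  have htz : ∀ {t z : V}, t ∈ S → G.Undominated S z → t ≠ z ∧ ¬ G.Adj t z :=
    fun {t z} ht hz => ⟨fun h => hz.1 (h ▸ ht), fun h => hz.2 t ht h.symm⟩
  have htt : t₁ ≠ t₂ ∧ ¬ G.Adj t₁ t₂ :=
    ⟨h22, fun h => h12 (((he₁.2.2.2 t₂ he₂.2.1).1 h).symm)⟩
  have hap : ∀ {p q r : V}, G.Adj p r → G.Adj r q → ¬ G.Adj p q := fun h h' => hfree _ _ _ h h'
  rcases eq_or_ne z₁ z₂ with rfl | hz
  · by_cases hdz : G.Adj d z₁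
    · refine key ((isStarForest_pair hty₁).union (isStarForest_pair hty₂) ?_) ?_
      · simp only [mem_insert, mem_singleton, forall_eq_or_imp, forall_eq]
        exact ⟨⟨htt, htp he₁.2.1 hy₂ h22⟩,
          ⟨(htp he₂.2.1 hy₁ h22.symm).1.symm, fun h => (htp he₂.2.1 hy₁ h22.symm).2 h.symm⟩,
          hpp hy₁ hy₂ h22, hap hyz₁ hyz₂.symm⟩
      · simp only [mem_insert, mem_singleton, mem_union, or_imp, forall_and, forall_eq]
        exact ⟨⟨hPt₁, hPy₁ (hap hdz hyz₁.symm)⟩, hPt₂, hPy₂⟩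
    · refine key (isStarForest_star haz₁.symm haz₂.symm hyz₂.symm
        ⟨hpp ha₁ ha₂ hne, hap haz₁ haz₂.symm⟩ ⟨hpp ha₁ hy₂ h12, hap haz₁ hyz₂.symm⟩
        ⟨hpp ha₂ hy₂ hst₂.ne, hay₂⟩) ?_
      simp only [mem_insert, mem_singleton, or_imp, forall_and, forall_eq]
      exact ⟨hPz₁ hdz, hPa₁, hPa₂, hPy₂⟩
  · have hz₂a := huniq he₂ ha₂ hz₂ hz₁ haz₂ hz.symm
    have hz₂y := huniq he₂.symm hy₂ hz₂ hz₁ hyz₂ hz.symm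
    have hzz := hS.not_adj_of_undominated hz₁ hz₂
    -- An edge br of the first pentagon is chosen to miss d; r misses the path t₂y₂z₂a₂, while b can
    -- be adjacent only to a₂ and y₂ on it. According to these two adjacencies, `T` is a claw at b,
    -- or br with t₂y₂, or br with a₂z₂.
    obtain ⟨b, r, hb, hr, hbr, hbt, hbz, hba, hby, hra, hry, hrt, hrz⟩ : ∃ b r, P b ∧ P r ∧
        G.Adj b r ∧ (t₂ ≠ b ∧ ¬ G.Adj t₂ b) ∧ (b ≠ z₂ ∧ ¬ G.Adj b z₂) ∧ b ≠ a₂ ∧ b ≠ y₂ ∧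
        (a₂ ≠ r ∧ ¬ G.Adj a₂ r) ∧ (y₂ ≠ r ∧ ¬ G.Adj y₂ r) ∧ (t₂ ≠ r ∧ ¬ G.Adj t₂ r) ∧
        (r ≠ z₂ ∧ ¬ G.Adj r z₂) := by
      by_cases hdz : G.Adj d z₁
      · refine ⟨y₁, t₁, hPy₁ (hap hdz hyz₁.symm), hPt₁, hty₁.symm, htp he₂.2.1 hy₁ h22.symm,
          huniq he₁.symm hy₁ hz₁ hz₂ hyz₁ hz, hpp hy₁ ha₂ h21.symm, hpp hy₁ hy₂ h22, ?_, ?_, ?_,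
          htz he₁.2.1 hz₂⟩
        · exact ⟨(htp he₁.2.1 ha₂ h21.symm).1.symm, fun h => (htp he₁.2.1 ha₂ h21.symm).2 h.symm⟩
        · exact ⟨(htp he₁.2.1 hy₂ h22).1.symm, fun h => (htp he₁.2.1 hy₂ h22).2 h.symm⟩
        · exact ⟨h22.symm, fun h => htt.2 h.symm⟩
      · exact ⟨a₁, z₁, hPa₁, hPz₁ hdz, haz₁, htp he₂.2.1 ha₁ h12.symm,
          huniq he₁ ha₁ hz₁ hz₂ haz₁ hz, hpp ha₁ ha₂ hne, hpp ha₁ hy₂ h12, hz₂a, hz₂y,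
          htz he₂.2.1 hz₁, hz, hzz⟩
    have hPz₂' := hPz₂ (hdz₂ hz)
    by_cases h1 : G.Adj b a₂
    · by_cases h2 : G.Adj b y₂
      · refine key (isStarForest_star hbr h1 h2 ⟨hra.1.symm, fun h => hra.2 h.symm⟩
          ⟨hry.1.symm, fun h => hry.2 h.symm⟩ ⟨hpp ha₂ hy₂ hst₂.ne, hay₂⟩) ?_
        simp only [mem_insert, mem_singleton, or_imp, forall_and, forall_eq]
        exact ⟨hb, hr, hPa₂, hPy₂⟩
      · refine key ((isStarForest_pair hbr).union (isStarForest_pair hty₂) ?_) ?_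
        · simp only [mem_insert, mem_singleton, forall_eq_or_imp, forall_eq]
          exact ⟨⟨⟨hbt.1.symm, fun h => hbt.2 h.symm⟩, hby, h2⟩,
            ⟨hrt.1.symm, fun h => hrt.2 h.symm⟩, hry.1.symm, fun h => hry.2 h.symm⟩
        · simp only [mem_insert, mem_singleton, mem_union, or_imp, forall_and, forall_eq]
          exact ⟨⟨hb, hr⟩, hPt₂, hPy₂⟩
    · refine key ((isStarForest_pair hbr).union (isStarForest_pair haz₂) ?_) ?_
      · simp only [mem_insert, mem_singleton, forall_eq_or_imp, forall_eq]
        exact ⟨⟨⟨hba, h1⟩, hbz⟩, ⟨hra.1.symm, fun h => hra.2 h.symm⟩, hrz⟩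
      · simp only [mem_insert, mem_singleton, mem_union, or_imp, forall_and, forall_eq]
        exact ⟨⟨hb, hr⟩, hPa₂, hPz₂'⟩

/-- A vertex whose neighbours in `S` are two vertices serving undominated vertices has no
neighbour among the undominated vertices that are not served. -/
lemma not_adj_of_two_serving (hfree : ∀ a b c, G.Adj a b → G.Adj b c → ¬ G.Adj a c)
    (hS : G.IsOptimal S) {s₁ s₂ z₁ z₂ d x : V} (h₁ : G.Serves S s₁ z₁) (h₂ : G.Serves S s₂ z₂)
    (hne : s₁ ≠ s₂) (hd : d ∉ S) (hds₁ : G.Adj d s₁) (hds₂ : G.Adj d s₂)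
    (hN : ∀ w ∈ S, G.Adj d w → w = s₁ ∨ w = s₂)
    (hcard : ∀ a b, G.Adj d a → G.Adj d b → a ∉ S → b ∉ S → a ≠ x → b ≠ x → a = b)
    (hx : G.Undominated S x) (hsx : ∀ s, ¬ G.Serves S s x) : ¬ G.Adj d x := by
  intro hdx
  have hz₁x : z₁ ≠ x := by rintro rfl; exact hsx _ h₁
  have hz₂x : z₂ ≠ x := by rintro rfl; exact hsx _ h₂
  obtain ⟨t₁, a₁, y₁, he₁, ha₁, hy₁, hz₁, haz₁, hyz₁, hay₁⟩ := hS.exists_pentagon hfree h₁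
  obtain ⟨t₂, a₂, y₂, he₂, ha₂, hy₂, hz₂, haz₂, hyz₂, hay₂⟩ := hS.exists_pentagon hfree h₂
  have hyx : ∀ {y t}, G.IsPrivate S y t → y ≠ x := by
    rintro y t hy rfl; exact hx.2 t hy.2.1 ((hy.2.2 t hy.2.1).2 rfl)
  have hyz : ∀ {y t z}, G.IsPrivate S y t → G.Undominated S z → y ≠ z := by
    rintro y t z hy hz rfl; exact hz.2 t hy.2.1 ((hy.2.2 t hy.2.1).2 rfl)
  have ht : t₁ ≠ t₂ := by
    rintro rfl
    exact hne ((he₁.2.2.2 s₂ he₂.1).1 he₂.adj.symm).symm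
  have hyy : y₁ ≠ y₂ := by
    rintro rfl
    exact ht ((hy₂.2.2 t₁ hy₁.2.1).1 ((hy₁.2.2 t₁ hy₁.2.1).2 rfl))
  -- Besides s₁, s₂ and x, d has at most one neighbour outside S, so it can spoil only one pentagon;
  -- if that is the second, the two exchange roles.
  by_cases h : ¬ G.Adj d y₂ ∧ (z₁ ≠ z₂ → ¬ G.Adj d z₂)
  · exact hS.false_of_two_pentagons hfree he₁ ha₁ hy₁ hz₁ haz₁ hyz₁ he₂ ha₂ hy₂ hz₂ haz₂ hyz₂
      hay₂ hne hd hds₁ hds₂ hN hx hsx hdx h.1 h.2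
  · have : (G.Adj d y₂ ∨ z₁ ≠ z₂ ∧ G.Adj d z₂) := by tauto
    refine hS.false_of_two_pentagons hfree he₂ ha₂ hy₂ hz₂ haz₂ hyz₂ he₁ ha₁ hy₁ hz₁ haz₁ hyz₁
      hay₁ hne.symm hd hds₂ hds₁ (fun w hw h => (hN w hw h).symm) hx hsx hdx ?_ ?_
    · rintro h'
      rcases this with h'' | ⟨_, h''⟩
      · exact hyy (hcard _ _ h' h'' hy₁.1 hy₂.1 (hyx hy₁) (hyx hy₂))
      · exact hyz hy₁ hz₂ (hcard _ _ h' h'' hy₁.1 hz₂.1 (hyx hy₁) hz₂x)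
    · rintro hzz h'
      rcases this with h'' | ⟨_, h''⟩
      · exact hyz hy₂ hz₁ (hcard _ _ h'' h' hy₂.1 hz₁.1 (hyx hy₂) hz₁x)
      · exact hzz (hcard _ _ h'' h' hz₂.1 hz₁.1 hz₂x hz₁x)

end IsOptimal

end SimpleGraph

/-! ### Discharging in 4-regular triangle-free graphs -/

namespace SimpleGraph

variable {V : Type u} {G : SimpleGraph V}

lemma isEdgeComponent_iff {S : Finset V} {s t : V} :
    G.IsEdgeComponent S s t ↔ s ∈ S ∧ t ∈ S ∧ G.nbr S s = {t} ∧ G.nbr S t = {s} := by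
  simp only [IsEdgeComponent, Finset.ext_iff, mem_nbr, mem_singleton]
  constructor
  · rintro ⟨hs, ht, h1, h2⟩
    exact ⟨hs, ht, fun a => ⟨fun h => (h1 a h.1).1 h.2, fun h => ⟨h ▸ ht, (h1 a (h ▸ ht)).2 h⟩⟩,
      fun a => ⟨fun h => (h2 a h.1).1 h.2, fun h => ⟨h ▸ hs, (h2 a (h ▸ hs)).2 h⟩⟩⟩
  · rintro ⟨hs, ht, h1, h2⟩
    exact ⟨hs, ht, fun w hw => ⟨fun h => (h1 w).1 ⟨hw, h⟩, fun h => ((h1 w).2 h).2⟩,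
      fun w hw => ⟨fun h => (h2 w).1 ⟨hw, h⟩, fun h => ((h2 w).2 h).2⟩⟩

lemma StarForest.exists_isStarComponent {S : Finset V} (h : G.StarForest S) {c : V} (hc : c ∈ S)
    (h3 : #(G.nbr S c) = 3) {a : V} (ha : a ∈ G.nbr S c) :
    ∃ b e, G.IsStarComponent S c a b e := by
  classical
  have hleaf : ∀ w ∈ G.nbr S c, w ∈ S ∧ ∀ v ∈ S, G.Adj w v ↔ v = c := by
    intro w hw
    have h1 := ((h c hc).resolve_left (by omega)).2 w hw
    obtain ⟨v, hv⟩ := card_eq_one.1 h1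
    have hcv : c ∈ G.nbr S w := mem_nbr.2 ⟨hc, (mem_nbr.1 hw).2.symm⟩
    rw [hv, mem_singleton] at hcv
    subst hcv
    refine ⟨(mem_nbr.1 hw).1, fun v hv' => ?_⟩
    rw [← mem_singleton, ← hv, mem_nbr]; tauto
  have h2 : #((G.nbr S c).erase a) = 2 := by rw [card_erase_of_mem ha]; omega
  obtain ⟨b, e, hbe, heq⟩ := card_eq_two.1 h2
  have hN : G.nbr S c = {a, b, e} := by rw [← insert_erase ha, heq]
  have hb : b ∈ (G.nbr S c).erase a := by rw [heq]; simp
  have he : e ∈ (G.nbr S c).erase a := by rw [heq]; simp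
  rw [mem_erase] at hb he
  refine ⟨b, e, ⟨hc, (hleaf a ha).1, (hleaf b hb.2).1, (hleaf e he.2).1⟩,
    ⟨hb.1.symm, he.1.symm, hbe⟩, fun w hw => ?_, (hleaf a ha).2, (hleaf b hb.2).2, (hleaf e he.2).2⟩
  have : w ∈ G.nbr S c ↔ w ∈ ({a, b, e} : Finset V) := by rw [hN]
  simpa [hw] using this

/-- A vertex lies in a K₂, is a leaf, or is a centre. A leaf is listed first among the leaves, as
`not_adj_of_private_leaf` expects. -/
lemma StarForest.cases {S : Finset V} (h : G.StarForest S) {s : V} (hs : s ∈ S) :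
    (∃ t, G.IsEdgeComponent S s t) ∨
    (∃ c b e, G.IsStarComponent S c s b e ∧ G.nbr S s = {c} ∧ #(G.nbr S c) = 3) ∨
    (∃ a b e, G.IsStarComponent S s a b e ∧ #(G.nbr S s) = 3 ∧
      ∀ w ∈ G.nbr S s, #(G.nbr S w) = 1) := by
  rcases h s hs with h1 | h3
  · obtain ⟨t, ht⟩ := card_eq_one.1 h1
    have htm : t ∈ G.nbr S s := by rw [ht]; simp
    have hst : s ∈ G.nbr S t := mem_nbr.2 ⟨hs, (mem_nbr.1 htm).2.symm⟩
    rcases h t (mem_nbr.1 htm).1 with h1' | h3'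
    · obtain ⟨v, hv⟩ := card_eq_one.1 h1'
      rw [hv, mem_singleton] at hst
      subst hst
      exact Or.inl ⟨t, isEdgeComponent_iff.2 ⟨hs, (mem_nbr.1 htm).1, ht, hv⟩⟩
    · obtain ⟨b, e, hc⟩ := h.exists_isStarComponent (mem_nbr.1 htm).1 h3'.1 hst
      exact Or.inr (Or.inl ⟨t, b, e, hc, ht, h3'.1⟩)
  · obtain ⟨a, ha⟩ : (G.nbr S s).Nonempty := card_pos.1 (by omega)
    obtain ⟨b, e, hc⟩ := h.exists_isStarComponent hs h3.1 ha
    exact Or.inr (Or.inr ⟨a, b, e, hc, h3⟩)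

lemma sum_nbr_comm (G : SimpleGraph V) (A B : Finset V) (f : V → V → ℚ) :
    ∑ a ∈ A, ∑ b ∈ G.nbr B a, f a b = ∑ b ∈ B, ∑ a ∈ G.nbr A b, f a b :=
  Finset.sum_comm' fun a b => by simp only [mem_nbr, G.adj_comm]; tauto

open Classical in
/-- The amount that the vertex `s` of the star forest `S` contributes to its neighbour `d`. -/
noncomputable def contribution (G : SimpleGraph V) (S : Finset V) (s d : V) : ℚ :=
  if (∃ t, G.IsEdgeComponent S s t) ∧ ¬ G.IsPrivate S d s then
    if ∃ x, G.Serves S s x then 1 / 2 else 3 / 4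
  else 1

lemma half_le_contribution (S : Finset V) (s d : V) : 1 / 2 ≤ G.contribution S s d := by
  unfold contribution; split_ifs <;> norm_num

lemma contribution_of_private {S : Finset V} {s d : V} (h : G.IsPrivate S d s) :
    G.contribution S s d = 1 := by
  simp [contribution, h]

lemma three_quarters_le_contribution {S : Finset V} {s d : V} (h : ¬ ∃ x, G.Serves S s x) :
    3 / 4 ≤ G.contribution S s d := by
  unfold contribution; split_ifs <;> norm_num

lemma contribution_of_not_edge {S : Finset V} {s d : V} (h : ¬ ∃ t, G.IsEdgeComponent S s t) :
    G.contribution S s d = 1 := by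
  simp [contribution, h]

variable [Fintype V] [DecidableEq V]

namespace IsOptimal

/-- By the number of neighbours of d in S. One: d is private, receives 1 and has no neighbour in U.
Two: 1/2 + 1/2 covers no neighbour in U; with one, the two cannot both serve, so 1/2 + 3/4; with
two, 3/4 + 3/4, or 1/2 + 1 since a serving vertex forces the other into a star. Three or four: 1/2
from each is enough. -/
lemma le_sum_contribution (h4 : ∀ v, #(G.nbr univ v) = 4)
    (hfree : ∀ a b c, G.Adj a b → G.Adj b c → ¬ G.Adj a c) {S : Finset V} (hS : G.IsOptimal S)
    {U : Finset V} (hU : ∀ x ∈ U, G.Undominated S x ∧ ∀ s, ¬ G.Serves S s x)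
    {d : V} (hd : d ∉ S) (hdS : ∃ s ∈ S, G.Adj d s) :
    1 + (#(G.nbr U d) : ℚ) / 4 ≤ ∑ s ∈ G.nbr S d, G.contribution S s d := by
  have hdisj : Disjoint S U := by
    rw [Finset.disjoint_left]; exact fun x hx hxU => (hU x hxU).1.1 hx
  have hle : #(G.nbr S d) + #(G.nbr U d) ≤ 4 := by
    rw [← card_nbr_union hdisj, ← h4 d]
    exact card_le_card (nbr_mono (subset_univ _) _)
  have hpos : 0 < #(G.nbr S d) := by
    obtain ⟨s, hs, hds⟩ := hdS
    exact card_pos.2 ⟨s, mem_nbr.2 ⟨hs, hds⟩⟩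
  have hhalf : (#(G.nbr S d) : ℚ) * (1 / 2) ≤ ∑ s ∈ G.nbr S d, G.contribution S s d := by
    rw [← nsmul_eq_mul]
    exact card_nsmul_le_sum _ _ _ fun s _ => half_le_contribution S s d
  obtain h | h | h | h : #(G.nbr S d) = 1 ∨ #(G.nbr S d) = 2 ∨ #(G.nbr S d) = 3 ∨
      #(G.nbr S d) = 4 := by omega
  · obtain ⟨s, hs⟩ := card_eq_one.1 h
    have hsm : s ∈ G.nbr S d := by rw [hs]; simp
    have hp : G.IsPrivate S d s := by
      refine ⟨hd, (mem_nbr.1 hsm).1, fun w hw => ?_⟩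
      rw [← mem_singleton, ← hs, mem_nbr]; tauto
    have : G.nbr U d = ∅ := by
      rw [nbr_eq_empty]
      intro x hx hdx
      rcases hS.forest.cases hp.2.1 with ⟨t, ht⟩ | ⟨c, b, e, hc, -⟩ | ⟨a, b, e, hc, -⟩
      · exact (hU x hx).2 s ⟨(hU x hx).1, ⟨t, ht⟩, d, hp, hdx⟩
      · exact hS.not_adj_of_private_leaf hc hp (hU x hx).1 hdx
      · exact hS.not_adj_of_private_center hc hp (hU x hx).1 hdx
    rw [hs, sum_singleton, contribution_of_private hp, this]; simp
  · obtain ⟨s₁, s₂, hne, hs⟩ := card_eq_two.1 h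
    have hs₁ : s₁ ∈ G.nbr S d := by rw [hs]; simp
    have hs₂ : s₂ ∈ G.nbr S d := by rw [hs]; simp
    have hN : ∀ w ∈ S, G.Adj d w → w = s₁ ∨ w = s₂ := by
      intro w hw hdw
      have : w ∈ G.nbr S d := mem_nbr.2 ⟨hw, hdw⟩
      rw [hs] at this
      simpa using this
    rw [mem_nbr] at hs₁ hs₂
    rw [hs, sum_pair hne]
    have a1 := half_le_contribution (G := G) S s₁ d
    have a2 := half_le_contribution (G := G) S s₂ d
    obtain h' | h' | h' : #(G.nbr U d) = 0 ∨ #(G.nbr U d) = 1 ∨ #(G.nbr U d) = 2 := by omega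
    · rw [h']; norm_num; linarith
    · rw [h']
      by_cases hb : (∃ x, G.Serves S s₁ x) ∧ ∃ x, G.Serves S s₂ x
      · exfalso
        obtain ⟨⟨z₁, h₁⟩, z₂, h₂⟩ := hb
        obtain ⟨x, hx⟩ := card_eq_one.1 h'
        have hxm : x ∈ G.nbr U d := by rw [hx]; simp
        rw [mem_nbr] at hxm
        refine hS.not_adj_of_two_serving hfree h₁ h₂ hne hd hs₁.2 hs₂.2 hN ?_ (hU x hxm.1).1
          (hU x hxm.1).2 hxm.2
        intro a b ha hb haS hbS hax hbx
        by_contra hab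
        have hxS := (hU x hxm.1).1.1
        have h5 : ({s₁, s₂, x, a, b} : Finset V) ⊆ G.nbr univ d := by
          simp [insert_subset_iff, *]
        have h6 : #({s₁, s₂, x, a, b} : Finset V) = 5 := by
          rw [card_insert_of_notMem, card_insert_of_notMem, card_insert_of_notMem, card_pair hab]
          all_goals simp only [mem_insert, mem_singleton]; grind
        have := card_le_card h5
        rw [h4, h6] at this
        omega
      · rcases not_and_or.1 hb with hb | hb
        · have := three_quarters_le_contribution (d := d) hb
          norm_num; linarith
        · have := three_quarters_le_contribution (d := d) hb
          norm_num; linarith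
    · rw [h']
      obtain ⟨x, x', hxx, hx⟩ := card_eq_two.1 h'
      have hxm : x ∈ G.nbr U d := by rw [hx]; simp
      have hxm' : x' ∈ G.nbr U d := by rw [hx]; simp
      rw [mem_nbr] at hxm hxm'
      have hxS := (hU x hxm.1).1.1
      have hxS' := (hU x' hxm'.1).1.1
      have h5 : ({s₁, s₂, x, x'} : Finset V) ⊆ G.nbr univ d := by
        simp [insert_subset_iff, *]
      have h6 : #({s₁, s₂, x, x'} : Finset V) = 4 := by
        rw [card_insert_of_notMem, card_insert_of_notMem, card_pair hxx]
        all_goals simp only [mem_insert, mem_singleton]; grind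
      have h7 := eq_of_subset_of_card_le h5 (by rw [h4, h6])
      have h8 : ∀ w, G.Adj d w ↔ w = s₁ ∨ w = s₂ ∨ w = x ∨ w = x' := by
        intro w
        have : w ∈ G.nbr univ d ↔ w ∈ ({s₁, s₂, x, x'} : Finset V) := by rw [h7]
        simpa using this
      have key : ∀ r₁ r₂, r₁ ≠ r₂ → (∀ w, G.Adj d w ↔ w = r₁ ∨ w = r₂ ∨ w = x ∨ w = x') →
          (∃ x, G.Serves S r₁ x) → G.contribution S r₂ d = 1 := by
        rintro r₁ r₂ hr hN' ⟨z, hz⟩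
        refine contribution_of_not_edge ?_
        rintro ⟨t, ht⟩
        exact hS.not_two_unserved hfree hz ht hr hd hN' hxx (hU x hxm.1).1 (hU x' hxm'.1).1
          (hU x hxm.1).2 (hU x' hxm'.1).2
      by_cases b1 : ∃ x, G.Serves S s₁ x
      · have := key s₁ s₂ hne h8 b1
        rw [this]; norm_num; linarith
      · by_cases b2 : ∃ x, G.Serves S s₂ x
        · have := key s₂ s₁ hne.symm (fun w => by rw [h8 w]; tauto) b2
          rw [this]; norm_num; linarith
        · have := three_quarters_le_contribution (d := d) b1
          have := three_quarters_le_contribution (d := d) b2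
          norm_num; linarith
  · rw [h] at hhalf hle
    have : (#(G.nbr U d) : ℚ) ≤ 1 := by exact_mod_cast (by omega : #(G.nbr U d) ≤ 1)
    push_cast at hhalf; linarith
  · rw [h] at hhalf hle
    have : #(G.nbr U d) = 0 := by omega
    rw [this]
    push_cast at hhalf ⊢; linarith

-- A vertex of a K₂ has three outside neighbours, at most one private: it sends at most 1 + 2 · 3/4,
-- or 1 + 2 · 1/2 if it serves. A leaf sends 3 and a centre 1; the last sum shifts 1/2 along each
-- leaf–centre edge and, being antisymmetric, cancels over S.
open Classical in
lemma sum_contribution_le (h4 : ∀ v, #(G.nbr univ v) = 4)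
    (hfree : ∀ a b c, G.Adj a b → G.Adj b c → ¬ G.Adj a c) {S : Finset V} (hS : G.IsOptimal S)
    {s : V} (hs : s ∈ S) :
    ∑ d ∈ G.nbr Sᶜ s, G.contribution S s d + (if ∃ x, G.Serves S s x then 1 / 2 else 0) ≤
      5 / 2 + ∑ r ∈ G.nbr S s, ((#(G.nbr S r) : ℚ) - #(G.nbr S s)) / 4 := by
  have hcard : #(G.nbr S s) + #(G.nbr Sᶜ s) = 4 := by
    rw [← card_nbr_union disjoint_compl_right, union_compl, h4]
  have hstar : ∀ {c a b e}, G.IsStarComponent S c a b e → (s = c ∨ s = a) →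
      ¬ ∃ t, G.IsEdgeComponent S s t := by
    rintro c a b e ⟨⟨hc, ha, hb, he⟩, ⟨hab, -⟩, h1, h2, -⟩ hsc ⟨t, hs, ht, h3, h4⟩
    rcases hsc with rfl | rfl
    · exact hab (((h3 a ha).1 ((h1 a ha).2 (by simp))).trans
        ((h3 b hb).1 ((h1 b hb).2 (by simp))).symm)
    · obtain rfl := (h3 c hc).1 ((h2 c hc).2 rfl)
      exact hab ((h4 b hb).1 ((h1 b hb).2 (by simp))).symm
  have hnotserve : (¬ ∃ t, G.IsEdgeComponent S s t) → ¬ ∃ x, G.Serves S s x :=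
    fun h ⟨x, hx⟩ => h hx.2.1
  rcases hS.forest.cases hs with ⟨t, ht⟩ | ⟨c, b, e, hc, hsn, hcn⟩ | ⟨a, b, e, hc, hsn, hn⟩
  · obtain ⟨-, -, h1, h2⟩ := isEdgeComponent_iff.1 ht
    rw [h1, sum_singleton, h2]
    rw [h1, card_singleton] at hcard
    have hpriv : #{d ∈ G.nbr Sᶜ s | G.IsPrivate S d s} ≤ 1 := by
      rw [card_le_one]
      intro a ha b hb
      exact hS.private_unique hfree ht (mem_filter.1 ha).2 (mem_filter.1 hb).2
    have hpriv' : (#{d ∈ G.nbr Sᶜ s | G.IsPrivate S d s} : ℚ) ≤ 1 := by exact_mod_cast hpriv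
    have hsum : ∀ q : ℚ, (∀ d, G.contribution S s d ≤
        q + (1 - q) * if G.IsPrivate S d s then 1 else 0) → q ≤ 1 →
        ∑ d ∈ G.nbr Sᶜ s, G.contribution S s d ≤ 1 + 2 * q := by
      intro q hq hq1
      refine (sum_le_sum fun d _ => hq d).trans ?_
      rw [sum_add_distrib, sum_const, ← mul_sum, sum_boole, nsmul_eq_mul]
      have : #(G.nbr Sᶜ s) = 3 := by omega
      rw [this]
      push_cast
      nlinarith
    have hE : ∃ t, G.IsEdgeComponent S s t := ⟨t, ht⟩
    by_cases hx : ∃ x, G.Serves S s x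
    · have := hsum (1 / 2) (fun d => by
        unfold contribution
        rw [if_pos hx]
        split_ifs <;> first | (norm_num; done) | (exfalso; tauto)) (by norm_num)
      rw [if_pos hx]; simp; linarith
    · have := hsum (3 / 4) (fun d => by
        unfold contribution
        rw [if_neg hx]
        split_ifs <;> first | (norm_num; done) | (exfalso; tauto)) (by norm_num)
      rw [if_neg hx]; simp; linarith
  · have hne := hstar hc (by simp)
    rw [if_neg (hnotserve hne), sum_congr rfl fun d _ => contribution_of_not_edge hne, hsn]
    rw [hsn, card_singleton] at hcard
    have : #(G.nbr Sᶜ s) = 3 := by omega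
    simp [this, hcn]; norm_num
  · have hne := hstar hc (by simp)
    rw [if_neg (hnotserve hne), sum_congr rfl fun d _ => contribution_of_not_edge hne,
      sum_congr (s₁ := G.nbr S s) rfl fun r hr => by rw [hn r hr], hsn]
    have : #(G.nbr Sᶜ s) = 1 := by omega
    simp [this, hsn]; norm_num

-- Double counting: both ends of the K₂ in a pentagon serve its undominated vertex, and each vertex
-- serves only one.
open Classical in
lemma two_mul_card_served_le (hfree : ∀ a b c, G.Adj a b → G.Adj b c → ¬ G.Adj a c)
    {S : Finset V} (hS : G.IsOptimal S) :
    2 * #{x | ∃ s, G.Serves S s x} ≤ #{s ∈ S | ∃ x, G.Serves S s x} := by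
  have h := card_mul_le_card_mul (s := ({x | ∃ s, G.Serves S s x} : Finset V))
    (t := {s ∈ S | ∃ x, G.Serves S s x}) (fun x s => G.Serves S s x) (m := 2) (n := 1) ?_ ?_
  · linarith
  · intro x hx
    obtain ⟨s, hs⟩ := (mem_filter.1 hx).2
    obtain ⟨t, a, y, he, ha, hy, hx', hax, hyx, -⟩ := hS.exists_pentagon hfree hs
    have ht : G.Serves S t x := ⟨hx', ⟨s, he.symm⟩, y, hy, hyx⟩
    rw [← card_pair he.adj.ne]
    apply card_le_card
    intro w
    simp only [mem_insert, mem_singleton, mem_bipartiteAbove, mem_filter]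
    rintro (rfl | rfl)
    exacts [⟨⟨he.1, x, hs⟩, hs⟩, ⟨⟨he.2.1, x, ht⟩, ht⟩]
  · intro s hs
    rw [card_le_one]
    intro a ha b hb
    rw [mem_bipartiteBelow] at ha hb
    exact hS.Serves_unique hfree ha.2 hb.2

open Classical in
lemma two_mul_card_le (h4 : ∀ v, #(G.nbr univ v) = 4)
    (hfree : ∀ a b c, G.Adj a b → G.Adj b c → ¬ G.Adj a c) {S : Finset V} (hS : G.IsOptimal S) :
    2 * Fintype.card V ≤ 7 * #S := by
  set D : Finset V := {d | d ∉ S ∧ ∃ s ∈ S, G.Adj d s} with hD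
  set W : Finset V := {x | ∃ s, G.Serves S s x} with hW
  set U : Finset V := {x | G.Undominated S x ∧ ∀ s, ¬ G.Serves S s x} with hU
  have hcard : Fintype.card V ≤ #S + #D + #W + #U := by
    rw [← card_univ]
    have : (univ : Finset V) ⊆ S ∪ D ∪ W ∪ U := by
      intro v _
      simp only [mem_union, hD, hW, hU, mem_filter, mem_univ, true_and]
      by_cases h1 : v ∈ S
      · tauto
      · by_cases h2 : ∃ s ∈ S, G.Adj v s
        · exact Or.inl (Or.inl (Or.inr ⟨h1, h2⟩))
        · push Not at h2
          by_cases h3 : ∃ s, G.Serves S s v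
          · tauto
          · push Not at h3
            exact Or.inr ⟨⟨h1, h2⟩, h3⟩
    refine (card_le_card this).trans ?_
    have := card_union_le (S ∪ D ∪ W) U
    have := card_union_le (S ∪ D) W
    have := card_union_le S D
    omega
  have h1 : ∑ d ∈ D, (1 + (#(G.nbr U d) : ℚ) / 4) ≤
      ∑ d ∈ D, ∑ s ∈ G.nbr S d, G.contribution S s d :=
    sum_le_sum fun d hd => by
      simp only [hD, mem_filter, mem_univ, true_and] at hd
      exact hS.le_sum_contribution h4 hfree (fun x hx => (mem_filter.1 hx).2) hd.1 hd.2
  have h2 : ∑ d ∈ D, (#(G.nbr U d) : ℚ) = 4 * #U := by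
    have := G.sum_nbr_comm D U fun _ _ => 1
    simp only [sum_const, nsmul_eq_mul, mul_one] at this
    rw [this, sum_congr rfl (g := fun _ => (4 : ℚ)), sum_const, nsmul_eq_mul, mul_comm]
    intro x hx
    have hx' := (mem_filter.1 hx).2.1
    have : G.nbr D x = G.nbr univ x := by
      ext w
      simp only [mem_nbr, mem_univ, true_and, and_iff_right_iff_imp, hD, mem_filter]
      intro hxw
      refine ⟨fun hw => hx'.2 w hw hxw, ?_⟩
      by_contra! hc
      refine hS.not_adj_of_undominated hx' ⟨fun hw => hx'.2 w hw hxw, hc⟩ hxw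
    rw [this, h4]; norm_num
  have h3 : ∑ d ∈ D, ∑ s ∈ G.nbr S d, G.contribution S s d =
      ∑ s ∈ S, ∑ d ∈ G.nbr Sᶜ s, G.contribution S s d := by
    rw [sum_nbr_comm G D S fun d s => G.contribution S s d]
    refine sum_congr rfl fun s hs => sum_congr ?_ fun _ _ => rfl
    ext w
    simp only [hD, mem_nbr, mem_filter, mem_univ, true_and, mem_compl]
    exact ⟨fun h => ⟨h.1.1, h.2⟩, fun h => ⟨⟨h.1, s, hs, h.2.symm⟩, h.2⟩⟩
  have h5 := sum_le_sum fun s (hs : s ∈ S) => hS.sum_contribution_le h4 hfree hs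
  rw [sum_add_distrib, sum_add_distrib, ← h3, ← sum_filter, sum_const, sum_const] at h5
  have h6 : ∑ s ∈ S, ∑ r ∈ G.nbr S s, ((#(G.nbr S r) : ℚ) - #(G.nbr S s)) / 4 = 0 := by
    have h := G.sum_nbr_comm S S fun s r => ((#(G.nbr S r) : ℚ) - #(G.nbr S s)) / 4
    have h' : ∑ b ∈ S, ∑ a ∈ G.nbr S b, ((#(G.nbr S b) : ℚ) - #(G.nbr S a)) / 4 =
        - ∑ s ∈ S, ∑ r ∈ G.nbr S s, ((#(G.nbr S r) : ℚ) - #(G.nbr S s)) / 4 := by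
      rw [← sum_neg_distrib]
      refine sum_congr rfl fun _ _ => ?_
      rw [← sum_neg_distrib]
      exact sum_congr rfl fun _ _ => by ring
    rw [h'] at h
    linarith
  have h7 : (2 * #W : ℚ) ≤ #{s ∈ S | ∃ x, G.Serves S s x} := by
    exact_mod_cast hS.two_mul_card_served_le hfree
  rw [sum_add_distrib, ← sum_div, h2, sum_const] at h1
  simp only [nsmul_eq_mul] at h1 h5
  have h8 : (Fintype.card V : ℚ) ≤ #S + #D + #W + #U := by exact_mod_cast hcard
  have : (2 * Fintype.card V : ℚ) ≤ 7 * #S := by linarith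
  exact_mod_cast this

end IsOptimal

/-- The theorem for 4-regular triangle-free graphs. -/
theorem exists_oddOn_of_regular_of_triangleFree (h4 : ∀ v, #(G.nbr univ v) = 4)
    (hfree : ∀ a b c, G.Adj a b → G.Adj b c → ¬ G.Adj a c) :
    ∃ S, G.OddOn S ∧ 2 * Fintype.card V ≤ 7 * #S := by
  obtain ⟨S, hS⟩ := exists_isOptimal G
  exact ⟨S, hS.forest.oddOn, hS.two_mul_card_le h4 hfree⟩

end SimpleGraph

/-! ### Minimal counterexamples and extension of odd sets -/

namespace SimpleGraph

variable {V : Type u} {G : SimpleGraph V}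

/-- A cover contains a subcover each member of which is needed. -/
lemma exists_irredundant_cover {α β : Type*} [DecidableEq β] (r : β → α → Prop) (I : Finset α)
    (C : Finset β) (h : ∀ y ∈ I, ∃ c ∈ C, r c y) :
    ∃ K ⊆ C, (∀ y ∈ I, ∃ c ∈ K, r c y) ∧ ∀ c ∈ K, ∃ y ∈ I, r c y ∧ ∀ b ∈ K, r b y → b = c := by
  induction hn : #C using Nat.strong_induction_on generalizing C with
  | _ n ih =>
    by_cases hc : ∀ c ∈ C, ∃ y ∈ I, r c y ∧ ∀ b ∈ C, r b y → b = c
    · exact ⟨C, Subset.rfl, h, hc⟩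
    · push Not at hc
      obtain ⟨c, hcC, hc⟩ := hc
      obtain ⟨K, hK, h1, h2⟩ := ih #(C.erase c) (by rw [← hn]; exact card_erase_lt_of_mem hcC)
        (C.erase c) (fun y hy => by
          obtain ⟨b, hb, hby⟩ := h y hy
          by_cases hbc : b = c
          · subst hbc
            obtain ⟨a, ha, hay, hne⟩ := hc y hy hby
            exact ⟨a, mem_erase.2 ⟨hne, ha⟩, hay⟩
          · exact ⟨b, mem_erase.2 ⟨hbc, hb⟩, hby⟩) rfl
      exact ⟨K, hK.trans (erase_subset _ _), h1, h2⟩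

variable [DecidableEq V]

open Classical in
/-- Extending an odd set `S` by a set `B`, where the parity at a vertex of `S` that has an odd
number of neighbours in `B` is repaired by a further vertex `τ`. -/
lemma OddOn.exists_extension {S B : Finset V} (hS : G.OddOn S) (hd : Disjoint S B)
    (hB : ∀ b ∈ B, Odd (#(G.nbr S b) + #(G.nbr B b))) (τ : V → V)
    (hτ : ∀ s ∈ S, Odd #(G.nbr B s) → G.Adj s (τ s) ∧ τ s ∉ S ∧ τ s ∉ B ∧
      (∀ r ∈ S, G.Adj r (τ s) → r = s) ∧ (∀ b ∈ B, ¬ G.Adj b (τ s)) ∧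
      ∀ r ∈ S, Odd #(G.nbr B r) → ¬ G.Adj (τ r) (τ s)) :
    ∃ T, Disjoint S T ∧ G.OddOn (S ∪ T) ∧ #T = #B + #{s ∈ S | Odd #(G.nbr B s)} := by
  set F : Finset V := {s ∈ S | Odd #(G.nbr B s)} with hF
  have hFm : ∀ s ∈ F, s ∈ S ∧ Odd #(G.nbr B s) := fun s hs => mem_filter.1 hs
  have hinj : Set.InjOn τ F := by
    intro a ha b hb hab
    have ha' := hτ a (hFm a ha).1 (hFm a ha).2
    have hb' := hτ b (hFm b hb).1 (hFm b hb).2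
    exact hb'.2.2.2.1 a (hFm a ha).1 (hab ▸ ha'.1)
  have hBF : Disjoint B (F.image τ) := by
    rw [Finset.disjoint_left]
    intro b hb hb'
    obtain ⟨s, hs, rfl⟩ := mem_image.1 hb'
    exact (hτ s (hFm s hs).1 (hFm s hs).2).2.2.1 hb
  have hSF : Disjoint S (F.image τ) := by
    rw [Finset.disjoint_left]
    intro b hb hb'
    obtain ⟨s, hs, rfl⟩ := mem_image.1 hb'
    exact (hτ s (hFm s hs).1 (hFm s hs).2).2.1 hb
  have hnτ : ∀ v, (∀ s ∈ F, ¬ G.Adj v (τ s)) → G.nbr (F.image τ) v = ∅ := by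
    intro v hv
    rw [nbr_eq_empty]
    intro w hw
    obtain ⟨s, hs, rfl⟩ := mem_image.1 hw
    exact hv s hs
  -- Each τ s is pendant at s in the enlarged set, so it is odd itself and changes the parity at s
  -- alone.
  refine ⟨B ∪ F.image τ, disjoint_union_right.2 ⟨hd, hSF⟩, hS.union
    (disjoint_union_right.2 ⟨hd, hSF⟩) ?_ ?_, ?_⟩
  · intro t ht
    rw [card_nbr_union hBF]
    rcases mem_union.1 ht with ht | ht
    · rw [hnτ t fun s hs => (hτ s (hFm s hs).1 (hFm s hs).2).2.2.2.2.1 t ht]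
      simpa using hB t ht
    · obtain ⟨s, hs, rfl⟩ := mem_image.1 ht
      obtain ⟨h1, h2, h3, h4, h5, h6⟩ := hτ s (hFm s hs).1 (hFm s hs).2
      have e1 : G.nbr S (τ s) = {s} := by
        ext w
        simp only [mem_nbr, mem_singleton]
        exact ⟨fun h => h4 w h.1 h.2.symm, fun h => by rw [h]; exact ⟨(hFm s hs).1, h1.symm⟩⟩
      rw [e1, hnτ (τ s) fun r hr h => h6 r (hFm r hr).1 (hFm r hr).2 h.symm,
        nbr_eq_empty.2 fun b hb h => h5 b hb h.symm]
      simp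
  · intro s hs
    rw [card_nbr_union hBF]
    by_cases hsF : s ∈ F
    · have h1 := hτ s hs (hFm s hsF).2
      have e1 : G.nbr (F.image τ) s = {τ s} := by
        ext w
        simp only [mem_nbr, mem_singleton, mem_image]
        constructor
        · rintro ⟨⟨r, hr, rfl⟩, h⟩
          rw [(hτ r (hFm r hr).1 (hFm r hr).2).2.2.2.1 s hs h]
        · rintro rfl; exact ⟨⟨s, hsF, rfl⟩, h1.1⟩
      rw [e1, card_singleton]
      exact (hFm s hsF).2.add_odd odd_one
    · have hev : Even #(G.nbr B s) := by
        rw [← Nat.not_odd_iff_even]; exact fun h => hsF (mem_filter.2 ⟨hs, h⟩)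
      rw [hnτ s fun r hr h => hsF ?_]
      · simpa using hev
      · rwa [(hτ r (hFm r hr).1 (hFm r hr).2).2.2.2.1 s hs h]
  · rw [card_union_of_disjoint hBF, card_image_of_injOn hinj]

variable [Fintype V]

/-- A vertex-minimal counterexample to the existence of odd sets of order at least `2n/7`. -/
structure IsMinimalCounterexample (G : SimpleGraph V) : Prop where
  card_le_four : ∀ v, #(G.nbr univ v) ≤ 4
  exists_adj : ∀ v, ∃ w, G.Adj v w
  lt : ∀ S, G.OddOn S → 7 * #S < 2 * Fintype.card V
  exists_of_ssubset : ∀ W : Finset V, W ≠ univ → (∀ v ∈ W, ∃ w ∈ W, G.Adj v w) →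
    ∃ S ⊆ W, G.OddOn S ∧ 2 * #W ≤ 7 * #S

namespace IsMinimalCounterexample

/-- Minimality gives 7|S| ≥ 2(n − |X|) ≥ 2n − 14j, so 2j more vertices would reach the bound. -/
lemma reduce (hG : G.IsMinimalCounterexample) {X : Finset V} (hX : X.Nonempty) (j : ℕ)
    (hj : #X ≤ 7 * j) (hiso : ∀ v ∉ X, ∃ w ∉ X, G.Adj v w) :
    ∃ S, Disjoint S X ∧ G.OddOn S ∧ ∀ T, Disjoint S T → G.OddOn (S ∪ T) → #T < 2 * j := by
  obtain ⟨S, hSW, hS, hc⟩ := hG.exists_of_ssubset Xᶜ (fun h => by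
    obtain ⟨x, hx⟩ := hX
    have := mem_univ x
    rw [← h, mem_compl] at this
    exact this hx) (fun v hv => by
      obtain ⟨w, hw, h⟩ := hiso v (mem_compl.1 hv)
      exact ⟨w, mem_compl.2 hw, h⟩)
  refine ⟨S, ?_, hS, fun T hST hT => ?_⟩
  · rw [Finset.disjoint_left]
    exact fun x hx hxX => mem_compl.1 (hSW hx) hxX
  · have h1 := hG.lt _ hT
    rw [card_union_of_disjoint hST] at h1
    rw [card_compl] at hc
    have := card_le_univ X
    omega

/-- Removing a set that contains an odd set together with its neighbourhood. -/
lemma not_closed (hG : G.IsMinimalCounterexample) {X T : Finset V} (j : ℕ)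
    (hj : #X ≤ 7 * j) (hiso : ∀ v ∉ X, ∃ w ∉ X, G.Adj v w) (hTX : T ⊆ X) (hT : G.OddOn T)
    (hN : ∀ t ∈ T, ∀ w, G.Adj t w → w ∈ X) (hTj : 2 * j ≤ #T) (hT0 : T.Nonempty) : False := by
  obtain ⟨S, hSX, hS, h⟩ := hG.reduce (hT0.mono hTX) j hj hiso
  have hST : Disjoint S T := hSX.mono_right hTX
  have := h T hST (hS.union_of_not_adj hT hST fun s hs t ht hst =>
    Finset.disjoint_left.1 hSX hs (hN t ht s hst.symm))
  omega

end IsMinimalCounterexample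

end SimpleGraph

/-! ### Removing the neighbourhood of an edge, with repairs -/

namespace SimpleGraph

variable {V : Type u} {G : SimpleGraph V} [DecidableEq V] [Fintype V]

/-- The vertices adjacent to `u` or to `v`. -/
noncomputable def pairNbr (G : SimpleGraph V) (u v : V) : Finset V :=
  G.nbr univ u ∪ G.nbr univ v

lemma mem_pairNbr {u v w : V} : w ∈ G.pairNbr u v ↔ G.Adj u w ∨ G.Adj v w := by
  simp [pairNbr]

/-- `y` becomes isolated when `pairNbr G u v` is removed. -/
def IsCutOff (G : SimpleGraph V) (u v y : V) : Prop :=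
  y ∉ G.pairNbr u v ∧ ∀ w, G.Adj y w → w ∈ G.pairNbr u v

/-- When `K` is retained, no vertex is cut off by the removal of `pairNbr G u v`; every vertex `d`
of `K` has its own cut-off neighbour `τ d`. -/
structure IsRepair (G : SimpleGraph V) (u v : V) (K : Finset V) (τ : V → V) : Prop where
  subset : K ⊆ G.pairNbr u v
  left_notMem : u ∉ K
  right_notMem : v ∉ K
  cover : ∀ y, G.IsCutOff u v y → ∃ d ∈ K, G.Adj d y
  cutOff : ∀ d ∈ K, G.IsCutOff u v (τ d)
  adj : ∀ d ∈ K, G.Adj d (τ d)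
  unique : ∀ d ∈ K, ∀ b ∈ K, G.Adj b (τ d) → b = d

-- An irredundant subcover of the cut-off vertices: each retained vertex is the only one covering
-- its τ. The choice of `C` restricts which vertices may be retained.
open Classical in
lemma exists_isRepair {u v : V} (C : Finset V) (hC : C ⊆ G.pairNbr u v) (hu : u ∉ C) (hv : v ∉ C)
    (hcov : ∀ y, G.IsCutOff u v y → ∃ d ∈ C, G.Adj d y) :
    ∃ K ⊆ C, ∃ τ, G.IsRepair u v K τ := by
  obtain ⟨K, hK, h1, h2⟩ := exists_irredundant_cover G.Adj {y | G.IsCutOff u v y} C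
    (fun y hy => hcov y (mem_filter.1 hy).2)
  have : Nonempty V := ⟨u⟩
  choose! τ hτ using h2
  exact ⟨K, hK, τ, hK.trans hC, fun h => hu (hK h), fun h => hv (hK h),
    fun y hy => h1 y (by simpa using hy), fun d hd => (mem_filter.1 (hτ d hd).1).2,
    fun d hd => (hτ d hd).2.1, fun d hd => (hτ d hd).2.2⟩

namespace IsRepair

variable {u v : V} {K : Finset V} {τ : V → V}

/-- The set to be removed. -/
noncomputable def removed (_ : G.IsRepair u v K τ) : Finset V :=
  G.pairNbr u v \ K ∪ K.image τ

lemma mem_removed (h : G.IsRepair u v K τ) {w : V} :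
    w ∈ h.removed ↔ w ∈ G.pairNbr u v ∧ w ∉ K ∨ ∃ d ∈ K, τ d = w := by
  simp [removed]

lemma card_removed_le (h : G.IsRepair u v K τ) : #h.removed ≤ #(G.pairNbr u v) := by
  refine (card_union_le _ _).trans ?_
  have := card_sdiff_add_card_eq_card h.subset
  have : #(K.image τ) ≤ #K := card_image_le
  omega

lemma notMem_removed (h : G.IsRepair u v K τ) {d : V} (hd : d ∈ K) : d ∉ h.removed := by
  rw [mem_removed]
  rintro (⟨-, h'⟩ | ⟨b, hb, rfl⟩)
  · exact h' hd
  · exact (h.cutOff b hb).1 (h.subset hd)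

lemma mem_of_notMem_removed (h : G.IsRepair u v K τ) {w : V} (hw : w ∉ h.removed)
    (hw' : w ∈ G.pairNbr u v) : w ∈ K := by
  by_contra hK
  exact hw (h.mem_removed.2 (Or.inl ⟨hw', hK⟩))

lemma not_adj_τ (h : G.IsRepair u v K τ) {w d : V} (hw : w ∉ G.pairNbr u v) (hd : d ∈ K) :
    ¬ G.Adj w (τ d) := fun hwd => hw ((h.cutOff d hd).2 w hwd.symm)

lemma exists_adj_of_notMem (h : G.IsRepair u v K τ) {w : V} (hw : w ∉ G.pairNbr u v) :
    (∃ x, x ∉ G.pairNbr u v ∧ x ∉ h.removed ∧ G.Adj w x) ∨ ∃ d ∈ K, G.Adj w d := by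
  by_cases hc : G.IsCutOff u v w
  · obtain ⟨d, hd, hdw⟩ := h.cover w hc
    exact Or.inr ⟨d, hd, hdw.symm⟩
  · left
    simp only [IsCutOff, not_and, not_forall] at hc
    obtain ⟨x, hwx, hx⟩ := hc hw
    refine ⟨x, hx, ?_, hwx⟩
    rw [mem_removed]
    rintro (⟨h', -⟩ | ⟨b, hb, rfl⟩)
    · exact hx h'
    · exact h.not_adj_τ hw hb hwx

-- Otherwise `reduce` applies with j = 1. If u or v has an odd number of neighbours in S, it is
-- added alone, and repairing parity at those neighbours adds at least one more vertex. If both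
-- numbers are even, u and v are added together. Either way S grows by two.
open Classical in
lemma eight_le (hG : G.IsMinimalCounterexample) (huv : G.Adj u v) (h : G.IsRepair u v K τ)
    (hbad : ∀ d ∈ K, ∃ w ∉ h.removed, G.Adj d w) : 8 ≤ #(G.pairNbr u v) := by
  by_contra! hlt
  have huN : u ∈ G.pairNbr u v := mem_pairNbr.2 (Or.inr huv.symm)
  have hvN : v ∈ G.pairNbr u v := mem_pairNbr.2 (Or.inl huv)
  have huX : u ∈ h.removed := h.mem_removed.2 (Or.inl ⟨huN, h.left_notMem⟩)
  have hvX : v ∈ h.removed := h.mem_removed.2 (Or.inl ⟨hvN, h.right_notMem⟩)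
  obtain ⟨S, hSX, hS, hmax⟩ := hG.reduce (X := h.removed) ⟨u, huX⟩ 1
    (by have := h.card_removed_le; omega) (by
      intro w hw
      by_cases hwN : w ∈ G.pairNbr u v
      · exact hbad w (h.mem_of_notMem_removed hw hwN)
      · rcases h.exists_adj_of_notMem hwN with ⟨x, -, hx, hwx⟩ | ⟨d, hd, hwd⟩
        · exact ⟨x, hx, hwx⟩
        · exact ⟨d, h.notMem_removed hd, hwd⟩)
  rw [Finset.disjoint_left] at hSX
  have hSK : ∀ s ∈ S, s ∈ G.pairNbr u v → s ∈ K := fun s hs hsN =>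
    h.mem_of_notMem_removed (hSX hs) hsN
  have key : ∀ B ⊆ ({u, v} : Finset V), (∀ b ∈ B, Odd (#(G.nbr S b) + #(G.nbr B b))) →
      #B + #{s ∈ S | Odd #(G.nbr B s)} < 2 := by
    intro B hB hodd
    have hBuv : ∀ b ∈ B, b = u ∨ b = v := fun b hb => by simpa using hB hb
    have hBX : ∀ b ∈ B, b ∈ h.removed := fun b hb => by
      rcases hBuv b hb with rfl | rfl <;> assumption
    have hBN : ∀ b ∈ B, ∀ w, G.Adj b w → w ∈ G.pairNbr u v := fun b hb w hw => by
      rcases hBuv b hb with rfl | rfl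
      · exact mem_pairNbr.2 (Or.inl hw)
      · exact mem_pairNbr.2 (Or.inr hw)
    have hsK : ∀ s ∈ S, Odd #(G.nbr B s) → s ∈ K := by
      intro s hs ho
      obtain ⟨b, hb⟩ := card_pos.1 ho.pos
      rw [mem_nbr] at hb
      exact hSK s hs (hBN b hb.1 s hb.2.symm)
    obtain ⟨T, hT1, hT2, hT3⟩ := hS.exists_extension
      (Finset.disjoint_left.2 fun s hs hsB => hSX hs (hBX s hsB)) hodd τ (by
        intro s hs ho
        have hs' := hsK s hs ho
        have hc := h.cutOff s hs'
        refine ⟨h.adj s hs', ?_, ?_, ?_, ?_, ?_⟩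
        · exact fun hτ => hSX hτ (h.mem_removed.2 (Or.inr ⟨s, hs', rfl⟩))
        · intro hτ
          rcases hBuv _ hτ with e | e
          · exact hc.1 (by rw [e]; exact huN)
          · exact hc.1 (by rw [e]; exact hvN)
        · exact fun r hr hrs => h.unique s hs' r (hSK r hr (hc.2 r hrs.symm)) hrs
        · exact fun b hb hbs => hc.1 (hBN b hb _ hbs)
        · exact fun r hr hro hrs => hc.1 ((h.cutOff r (hsK r hr hro)).2 _ hrs))
    rw [← hT3]
    exact hmax T hT1 hT2
  have single : ∀ b, b = u ∨ b = v → ¬ Odd #(G.nbr S b) := by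
    intro b hb ho
    have h1 := key {b} (by rcases hb with rfl | rfl <;> simp) (by
      intro a ha
      rw [mem_singleton] at ha
      subst ha
      have e1 : G.nbr {a} a = ∅ := by
        rw [nbr_eq_empty]; intro w hw; rw [mem_singleton] at hw; rw [hw]; exact G.irrefl
      rw [e1]
      simpa using ho)
    obtain ⟨s, hs⟩ := card_pos.1 ho.pos
    rw [mem_nbr] at hs
    have h2 : 0 < #{s ∈ S | Odd #(G.nbr {b} s)} := card_pos.2 ⟨s, mem_filter.2 ⟨hs.1, by
      rw [card_nbr_singleton_of_adj hs.2.symm]; exact odd_one⟩⟩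
    rw [card_singleton] at h1
    omega
  have h1 := key {u, v} Subset.rfl (by
    have e1 : G.nbr {u, v} u = {v} := by
      ext w; simp only [mem_nbr, mem_insert, mem_singleton]
      exact ⟨fun h => h.1.resolve_left fun e => G.irrefl (e ▸ h.2), fun h => by simp [h, huv]⟩
    have e2 : G.nbr {u, v} v = {u} := by
      ext w; simp only [mem_nbr, mem_insert, mem_singleton]
      exact ⟨fun h => h.1.resolve_right fun e => G.irrefl (e ▸ h.2), fun h => by
        simp [h, huv.symm]⟩
    intro b hb
    have := single b (by simpa using hb)
    rw [Nat.not_odd_iff_even] at this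
    rw [mem_insert, mem_singleton] at hb
    rcases hb with rfl | rfl
    · rw [e1, card_singleton]; exact this.add_odd odd_one
    · rw [e2, card_singleton]; exact this.add_odd odd_one)
  rw [card_pair huv.ne] at h1
  omega

-- The isolated retained vertices B form with their τ an induced matching on 2|B| vertices, whose
-- neighbours all lie in the removed set together with B. Were |N(u) ∪ N(v)| ≤ 6, this would be at
-- most 6 + |B| ≤ 7|B| vertices, contrary to `not_closed`.
open Classical in
lemma lt_of_isolated (hG : G.IsMinimalCounterexample) (h : G.IsRepair u v K τ)
    (hbad : ∃ d ∈ K, ∀ w, G.Adj d w → w ∈ h.removed) : 7 ≤ #(G.pairNbr u v) := by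
  set B : Finset V := {d ∈ K | ∀ w, G.Adj d w → w ∈ h.removed} with hB
  have hBm : ∀ d ∈ B, d ∈ K ∧ ∀ w, G.Adj d w → w ∈ h.removed := fun d hd => mem_filter.1 hd
  have hB0 : B.Nonempty := by
    obtain ⟨d, hd, hd'⟩ := hbad
    exact ⟨d, mem_filter.2 ⟨hd, hd'⟩⟩
  by_contra! hlt
  have hpos := card_pos.2 hB0
  have hinj : Set.InjOn τ B := fun a ha b hb hab =>
    h.unique b (hBm b hb).1 a (hBm a ha).1 (hab ▸ h.adj a (hBm a ha).1)
  have hdisj : Disjoint B (B.image τ) := by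
    rw [Finset.disjoint_left]
    intro b hb hb'
    obtain ⟨d, hd, rfl⟩ := mem_image.1 hb'
    exact (h.cutOff d (hBm d hd).1).1 (h.subset (hBm _ hb).1)
  have hBB : ∀ a ∈ B, ∀ b ∈ B, ¬ G.Adj a b := fun a ha b hb hab =>
    h.notMem_removed (hBm b hb).1 ((hBm a ha).2 b hab)
  refine hG.not_closed (X := h.removed ∪ B) (T := B ∪ B.image τ) #B ?_ ?_ ?_ ?_ ?_ ?_ ?_
  · have h1 := card_union_le h.removed B
    have h2 := h.card_removed_le
    omega
  · intro w hw
    rw [mem_union, not_or] at hw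
    by_cases hwN : w ∈ G.pairNbr u v
    · have hwK := h.mem_of_notMem_removed hw.1 hwN
      have : ¬ ∀ x, G.Adj w x → x ∈ h.removed := fun h' => hw.2 (mem_filter.2 ⟨hwK, h'⟩)
      push Not at this
      obtain ⟨x, hwx, hx⟩ := this
      refine ⟨x, ?_, hwx⟩
      rw [mem_union, not_or]
      exact ⟨hx, fun hxB => hw.1 ((hBm x hxB).2 w hwx.symm)⟩
    · rcases h.exists_adj_of_notMem hwN with ⟨x, hxN, hx, hwx⟩ | ⟨d, hd, hwd⟩
      · refine ⟨x, ?_, hwx⟩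
        rw [mem_union, not_or]
        exact ⟨hx, fun hxB => hxN (h.subset (hBm x hxB).1)⟩
      · refine ⟨d, ?_, hwd⟩
        rw [mem_union, not_or]
        exact ⟨h.notMem_removed hd, fun hdB => hw.1 ((hBm d hdB).2 w hwd.symm)⟩
  · intro w hw
    rcases mem_union.1 hw with hw | hw
    · exact mem_union_right _ hw
    · obtain ⟨d, hd, rfl⟩ := mem_image.1 hw
      exact mem_union_left _ (h.mem_removed.2 (Or.inr ⟨d, (hBm d hd).1, rfl⟩))
  · intro w hw
    have : ∃ x, G.nbr (B ∪ B.image τ) w = {x} := by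
      rcases mem_union.1 hw with hw | hw
      · refine ⟨τ w, ?_⟩
        ext x
        simp only [mem_nbr, mem_union, mem_image, mem_singleton]
        constructor
        · rintro ⟨hx | ⟨d, hd, rfl⟩, hwx⟩
          · exact absurd hwx (hBB w hw x hx)
          · rw [h.unique d (hBm d hd).1 w (hBm w hw).1 hwx]
        · rintro rfl; exact ⟨Or.inr ⟨w, hw, rfl⟩, h.adj w (hBm w hw).1⟩
      · obtain ⟨d, hd, rfl⟩ := mem_image.1 hw
        have hdK := (hBm d hd).1
        refine ⟨d, ?_⟩
        ext x
        simp only [mem_nbr, mem_union, mem_image, mem_singleton]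
        constructor
        · rintro ⟨hx | ⟨b, hb, rfl⟩, hwx⟩
          · exact h.unique d hdK x (hBm x hx).1 hwx.symm
          · exact absurd hwx (h.not_adj_τ (h.cutOff d hdK).1 (hBm b hb).1)
        · rintro rfl; exact ⟨Or.inl hd, (h.adj x hdK).symm⟩
    obtain ⟨x, hx⟩ := this
    rw [hx, card_singleton]; exact odd_one
  · intro t ht w htw
    rcases mem_union.1 ht with ht | ht
    · exact mem_union_left _ ((hBm t ht).2 w htw)
    · obtain ⟨d, hd, rfl⟩ := mem_image.1 ht
      have hdK := (hBm d hd).1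
      have hwN := (h.cutOff d hdK).2 w htw
      by_cases hwK : w ∈ K
      · rw [h.unique d hdK w hwK htw.symm]; exact mem_union_right _ hd
      · exact mem_union_left _ (h.mem_removed.2 (Or.inl ⟨hwN, hwK⟩))
  · rw [card_union_of_disjoint hdisj, card_image_of_injOn hinj]; omega
  · exact hB0.mono subset_union_left

end IsRepair

end SimpleGraph

/-! ### A minimal counterexample is 4-regular and triangle-free -/

namespace SimpleGraph

variable {V : Type u} {G : SimpleGraph V} [DecidableEq V] [Fintype V]

namespace IsMinimalCounterexample

/-- Cut-off vertices are adjacent to neither u nor v, so the rest of N(u) ∪ N(v) covers them and a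
repair exists. -/
lemma seven_le (hG : G.IsMinimalCounterexample) {u v : V} (huv : G.Adj u v) :
    7 ≤ #(G.pairNbr u v) := by
  obtain ⟨K, -, τ, h⟩ := exists_isRepair (G := G) (u := u) (v := v) (G.pairNbr u v \ {u, v})
    sdiff_subset (by simp) (by simp) (by
      intro y hy
      obtain ⟨w, hw⟩ := hG.exists_adj y
      refine ⟨w, ?_, hw.symm⟩
      simp only [mem_sdiff, mem_insert, mem_singleton, not_or]
      refine ⟨hy.2 w hw, ?_, ?_⟩
      · rintro rfl; exact hy.1 (mem_pairNbr.2 (Or.inl hw.symm))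
      · rintro rfl; exact hy.1 (mem_pairNbr.2 (Or.inr hw.symm)))
  by_cases hbad : ∃ d ∈ K, ∀ w, G.Adj d w → w ∈ h.removed
  · exact h.lt_of_isolated hG hbad
  · push Not at hbad
    have := h.eight_le hG huv (fun d hd => by
      obtain ⟨w, h1, h2⟩ := hbad d hd
      exact ⟨w, h2, h1⟩)
    omega

lemma card_pairNbr_add (u v : V) : #(G.pairNbr u v) + #(G.nbr univ u ∩ G.nbr univ v) =
    #(G.nbr univ u) + #(G.nbr univ v) := card_union_add_card_inter _ _

lemma three_le (hG : G.IsMinimalCounterexample) (v : V) : 3 ≤ #(G.nbr univ v) := by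
  obtain ⟨w, hw⟩ := hG.exists_adj v
  have h1 := hG.seven_le hw
  have h2 := card_pairNbr_add (G := G) v w
  have h3 := hG.card_le_four w
  omega

/-- A vertex of degree 3 is the centre of an induced claw. -/
lemma exists_claw_of_card_eq_three (hG : G.IsMinimalCounterexample) {c : V}
    (hc : #(G.nbr univ c) = 3) : ∃ a b e, G.Adj c a ∧ G.Adj c b ∧ G.Adj c e ∧
      (a ≠ b ∧ ¬ G.Adj a b) ∧ (a ≠ e ∧ ¬ G.Adj a e) ∧ (b ≠ e ∧ ¬ G.Adj b e) := by
  obtain ⟨a, b, e, hab, hae, hbe, h⟩ := card_eq_three.1 hc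
  have hm : ∀ w, G.Adj c w ↔ w = a ∨ w = b ∨ w = e := by
    intro w
    have : w ∈ G.nbr univ c ↔ w ∈ ({a, b, e} : Finset V) := by rw [h]
    simpa using this
  have hnot : ∀ p q, G.Adj c p → G.Adj c q → ¬ G.Adj p q := by
    intro p q hp hq hpq
    have h1 := hG.seven_le hp
    have h2 := card_pairNbr_add (G := G) c p
    have h3 := hG.card_le_four p
    have h4 : 0 < #(G.nbr univ c ∩ G.nbr univ p) := card_pos.2 ⟨q, by simp [hq, hpq]⟩
    omega
  have ha := (hm a).2 (by simp)
  have hb := (hm b).2 (by simp)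
  have he := (hm e).2 (by simp)
  exact ⟨a, b, e, ha, hb, he, ⟨hab, hnot a b ha hb⟩, ⟨hae, hnot a e ha he⟩, hbe, hnot b e hb he⟩

lemma card_inter_le_one (hG : G.IsMinimalCounterexample) {u v : V} (huv : G.Adj u v) :
    #(G.nbr univ u ∩ G.nbr univ v) ≤ 1 := by
  have h1 := hG.seven_le huv
  have h2 := card_pairNbr_add (G := G) u v
  have h3 := hG.card_le_four u
  have h4 := hG.card_le_four v
  omega

-- Two cut-off vertices share a neighbour, each having at least 3 among the five vertices of N(u) ∪
-- N(v) other than u, v. So vertices with two cut-off neighbours would suffice as a cover; each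
-- retained one keeps a neighbour besides its τ, forcing order 8.
open Classical in
lemma exists_unique_cutOff (hG : G.IsMinimalCounterexample) {u v : V} (huv : G.Adj u v)
    (h7 : #(G.pairNbr u v) = 7) : ∃ y, G.IsCutOff u v y ∧ ∀ z, G.IsCutOff u v z → z = y := by
  have hy : ∃ y, G.IsCutOff u v y := by
    by_contra! h
    have := IsRepair.eight_le (K := ∅) (τ := id) hG huv
      ⟨by simp, by simp, by simp, fun y hy => absurd hy (h y), by simp, by simp, by simp⟩ (by simp)
    omega
  by_contra! hne
  obtain ⟨K, hKC, τ, h⟩ := exists_isRepair (G := G) (u := u) (v := v)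
    {m ∈ G.pairNbr u v \ {u, v} | ∃ y z, y ≠ z ∧ G.IsCutOff u v y ∧ G.IsCutOff u v z ∧
      G.Adj m y ∧ G.Adj m z} ((filter_subset _ _).trans sdiff_subset) (by simp) (by simp) (by
      intro y hy
      obtain ⟨z, hz, hzy⟩ := hne y hy
      have hsub : ∀ w, G.IsCutOff u v w → G.nbr univ w ⊆ G.pairNbr u v \ {u, v} := by
        intro w hw x hx
        simp only [mem_nbr, mem_univ, true_and] at hx
        simp only [mem_sdiff, mem_insert, mem_singleton, not_or]
        refine ⟨hw.2 x hx, ?_, ?_⟩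
        · rintro rfl; exact hw.1 (mem_pairNbr.2 (Or.inl hx.symm))
        · rintro rfl; exact hw.1 (mem_pairNbr.2 (Or.inr hx.symm))
      have h1 := card_le_card (union_subset (hsub y hy) (hsub z hz))
      have h2 : #(G.pairNbr u v \ {u, v}) = 5 := by
        rw [card_sdiff_of_subset, card_pair huv.ne, h7]
        simp only [insert_subset_iff, singleton_subset_iff, mem_pairNbr]
        exact ⟨Or.inr huv.symm, Or.inl huv⟩
      have h3 := card_union_add_card_inter (G.nbr univ y) (G.nbr univ z)
      have h4 := hG.three_le y
      have h5 := hG.three_le z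
      obtain ⟨m, hm⟩ := card_pos.1 (show 0 < #(G.nbr univ y ∩ G.nbr univ z) by omega)
      have hm' := hsub y hy (mem_inter.1 hm).1
      simp only [mem_inter, mem_nbr, mem_univ, true_and] at hm
      exact ⟨m, mem_filter.2 ⟨hm', y, z, hzy.symm, hy, hz, hm.1.symm, hm.2.symm⟩, hm.1.symm⟩)
  have := h.eight_le hG huv (by
    intro d hd
    obtain ⟨y, z, hyz, hy, hz, hdy, hdz⟩ := (mem_filter.1 (hKC hd)).2
    have key : ∀ w, G.IsCutOff u v w → G.Adj d w → w ≠ τ d → w ∉ h.removed := by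
      intro w hw hdw hne
      rw [h.mem_removed]
      rintro (⟨h', -⟩ | ⟨b, hb, rfl⟩)
      · exact hw.1 h'
      · rw [h.unique b hb d hd hdw] at hne; exact hne rfl
    by_cases hyτ : y = τ d
    · exact ⟨z, key z hz hdz (fun e => hyz (hyτ.trans e.symm)), hdz⟩
    · exact ⟨y, key y hy hdy hyτ, hdy⟩)
  omega

-- If the order is 7, adding the cut-off vertex y gives R of order 8, which turns out to be closed
-- under adjacency. An induced claw in R would be removable with R, so R is claw-free and hence
-- 4-regular. Then u and v each have a neighbour missed by the other and by y, and with N(y), u and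
-- v this makes eight vertices in N(u) ∪ N(v).
open Classical in
lemma eight_le (hG : G.IsMinimalCounterexample) {u v : V} (huv : G.Adj u v) :
    8 ≤ #(G.pairNbr u v) := by
  by_contra! hlt
  have h7 : #(G.pairNbr u v) = 7 := le_antisymm (by omega) (hG.seven_le huv)
  obtain ⟨y, hy, huniq⟩ := hG.exists_unique_cutOff huv h7
  have huN : u ∈ G.pairNbr u v := mem_pairNbr.2 (Or.inr huv.symm)
  have hvN : v ∈ G.pairNbr u v := mem_pairNbr.2 (Or.inl huv)
  have hyu : ¬ G.Adj y u := fun h => hy.1 (mem_pairNbr.2 (Or.inl h.symm))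
  have hyv : ¬ G.Adj y v := fun h => hy.1 (mem_pairNbr.2 (Or.inr h.symm))
  set R := insert y (G.pairNbr u v) with hR
  have hRc : #R = 8 := by rw [hR, card_insert_of_notMem hy.1, h7]
  have hNR : ∀ w, w ∈ G.pairNbr u v → w ∈ R := fun w hw => mem_insert_of_mem hw
  have huR : ∀ w, G.Adj u w → w ∈ R := fun w hw => hNR w (mem_pairNbr.2 (Or.inl hw))
  have hvR : ∀ w, G.Adj v w → w ∈ R := fun w hw => hNR w (mem_pairNbr.2 (Or.inr hw))
  have hyR : ∀ w, G.Adj y w → w ∈ R := fun w hw => hNR w (hy.2 w hw)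
  have hmR : ∀ m, G.Adj y m → ∀ w, G.Adj m w → w ∈ R := by
    intro m hm w hmw
    by_contra hw
    have hrep : G.IsRepair u v {m} (fun _ => y) :=
      ⟨by simpa using hy.2 m hm, by simp only [mem_singleton]; rintro rfl; exact hyu hm,
        by simp only [mem_singleton]; rintro rfl; exact hyv hm,
        fun z hz => ⟨m, by simp, by rw [huniq z hz]; exact hm.symm⟩, fun _ _ => hy,
        fun d hd => by rw [mem_singleton.1 hd]; exact hm.symm,
        fun d hd b hb _ => (mem_singleton.1 hb).trans (mem_singleton.1 hd).symm⟩
    have := hrep.eight_le hG huv (by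
      intro d hd
      rw [mem_singleton.1 hd]
      refine ⟨w, ?_, hmw⟩
      rw [hrep.mem_removed]
      rintro (⟨h, -⟩ | ⟨-, -, rfl⟩)
      · exact hw (hNR w h)
      · exact hw (mem_insert_self _ _))
    omega
  -- If e in R had a neighbour outside R, the seven vertices of R other than e could be removed, and
  -- an edge ym with m not adjacent to e could be added to any odd set in the rest.
  have hclosed : ∀ r ∈ R, ∀ w, G.Adj r w → w ∈ R := by
    intro e he w hew
    by_contra hw
    have hout : ∀ r x, G.Adj r x → x ∉ R → r ≠ u ∧ r ≠ v ∧ r ≠ y ∧ ¬ G.Adj y r := by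
      intro r x hrx hx
      refine ⟨?_, ?_, ?_, fun h => hx (hmR r h x hrx)⟩
      · rintro rfl; exact hx (huR x hrx)
      · rintro rfl; exact hx (hvR x hrx)
      · rintro rfl; exact hx (hyR x hrx)
    obtain ⟨heu, hev, hey, hye⟩ := hout e w hew hw
    have hyu' : y ≠ u := by rintro rfl; exact hy.1 huN
    have hyv' : y ≠ v := by rintro rfl; exact hy.1 hvN
    have hiso : ∀ x ∉ R.erase e, ∃ z ∉ R.erase e, G.Adj x z := by
      intro x hx
      by_cases hxe : x = e
      · exact ⟨w, fun h => hw (mem_of_mem_erase h), hxe ▸ hew⟩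
      · have hxR : x ∉ R := fun h => hx (mem_erase.2 ⟨hxe, h⟩)
        by_contra! hc
        -- If x became isolated, then N(x), N(y) and {u, v, y, e} would be disjoint subsets of R
        -- with at least 3 + 3 + 4 > 8 vertices.
        have h1 : G.nbr univ x ∪ (G.nbr univ y ∪ {u, v, y, e}) ⊆ R := by
          intro z hz
          simp only [mem_union, mem_nbr, mem_univ, true_and, mem_insert, mem_singleton] at hz
          rcases hz with hz | hz | rfl | rfl | rfl | rfl
          · by_contra hzR
            exact hc z (fun h => hzR (mem_of_mem_erase h)) hz
          · exact hyR z hz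
          · exact hNR _ huN
          · exact hNR _ hvN
          · exact mem_insert_self _ _
          · exact he
        have h2 : ∀ z, G.Adj x z → z ≠ e ∧ z ≠ u ∧ z ≠ v ∧ z ≠ y ∧ ¬ G.Adj y z := by
          intro z hz
          refine ⟨?_, hout z x hz.symm hxR⟩
          rintro rfl
          exact hc z (by simp) hz
        have h3 := card_le_card h1
        rw [card_union_of_disjoint, card_union_of_disjoint, card_insert_of_notMem,
          card_insert_of_notMem, card_pair hey.symm, hRc] at h3
        · have := hG.three_le x
          have := hG.three_le y
          omega
        · simp [hyv'.symm, hev.symm]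
        · simp [huv.ne, hyu'.symm, heu.symm]
        · rw [Finset.disjoint_left]
          intro z hz hz'
          simp only [mem_nbr, mem_univ, true_and, mem_insert, mem_singleton] at hz hz'
          rcases hz' with rfl | rfl | rfl | rfl
          exacts [hyu hz, hyv hz, G.irrefl hz, hye hz]
        · rw [Finset.disjoint_left]
          intro z hz hz'
          simp only [mem_nbr, mem_univ, true_and, mem_insert, mem_singleton, mem_union] at hz hz'
          have := h2 z hz
          tauto
    -- Otherwise e is adjacent to w, to u or v, and to at least three vertices of N(y), five in all.
    have hm : ∃ m, G.Adj y m ∧ ¬ G.Adj e m := by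
      by_contra! hc
      have heN : e ∈ G.pairNbr u v := (mem_insert.1 he).resolve_left hey
      obtain ⟨p, hp, hep⟩ : ∃ p, (p = u ∨ p = v) ∧ G.Adj e p := by
        rcases mem_pairNbr.1 heN with h | h
        exacts [⟨u, Or.inl rfl, h.symm⟩, ⟨v, Or.inr rfl, h.symm⟩]
      have hyp : ¬ G.Adj y p := by rcases hp with rfl | rfl <;> assumption
      have hpR : p ∈ R := by rcases hp with rfl | rfl; exacts [hNR _ huN, hNR _ hvN]
      have h1 : insert w (insert p (G.nbr univ y)) ⊆ G.nbr univ e := by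
        intro z hz
        simp only [mem_insert, mem_nbr, mem_univ, true_and] at hz ⊢
        rcases hz with rfl | rfl | hz
        exacts [hew, hep, hc z hz]
      have h2 := card_le_card h1
      rw [card_insert_of_notMem, card_insert_of_notMem] at h2
      · have := hG.three_le y
        have := hG.card_le_four e
        omega
      · simpa using hyp
      · simp only [mem_insert, mem_nbr, mem_univ, true_and, not_or]
        exact ⟨fun h => hw (h ▸ hpR), fun h => hw (hyR w h)⟩
    obtain ⟨m, hym, hem⟩ := hm
    have hmR' := hyR m hym
    have hme : m ≠ e := by rintro rfl; exact hye hym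
    have hXc : #(R.erase e) ≤ 7 * 1 := by rw [card_erase_of_mem he, hRc]
    obtain ⟨S, hSX, hS, hmax⟩ := hG.reduce (X := R.erase e) ⟨m, mem_erase.2 ⟨hme, hmR'⟩⟩ 1 hXc hiso
    rw [Finset.disjoint_left] at hSX
    have hSR : ∀ s ∈ S, s ∈ R → s = e := by
      intro s hs hsR
      by_contra hse
      exact hSX hs (mem_erase.2 ⟨hse, hsR⟩)
    have hd : Disjoint S {y, m} := by
      rw [Finset.disjoint_left]
      intro s hs hs'
      rw [mem_insert, mem_singleton] at hs'
      rcases hs' with rfl | rfl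
      · exact hey (hSR _ hs (mem_insert_self _ _)).symm
      · exact hme (hSR _ hs hmR')
    have := hmax {y, m} hd (hS.union_of_not_adj (isStarForest_pair hym).forest.oddOn hd (by
      intro s hs t ht hst
      rw [mem_insert, mem_singleton] at ht
      rcases ht with rfl | rfl
      · rw [hSR s hs (hyR s hst.symm)] at hst; exact hye hst.symm
      · rw [hSR s hs (hmR _ hym s hst.symm)] at hst; exact hem hst))
    rw [card_pair hym.ne] at this
    omega
  have hclaw : ∀ c ∈ R, ∀ a b e, G.Adj c a → G.Adj c b → G.Adj c e → (a ≠ b ∧ ¬ G.Adj a b) →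
      (a ≠ e ∧ ¬ G.Adj a e) → (b ≠ e ∧ ¬ G.Adj b e) → False := by
    intro c hc a b e ha hb he hab hae hbe
    have hT := isStarForest_star ha hb he hab hae hbe
    have hTR : ({c, a, b, e} : Finset V) ⊆ R := by
      simp only [insert_subset_iff, singleton_subset_iff]
      exact ⟨hc, hclosed c hc a ha, hclosed c hc b hb, hclosed c hc e he⟩
    refine hG.not_closed (X := R) 2 (by omega) ?_ hTR hT.forest.oddOn
      (fun t ht w htw => hclosed t (hTR ht) w htw) (by rw [hT.card]) ⟨c, by simp⟩
    intro x hx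
    obtain ⟨w, hw⟩ := hG.exists_adj x
    exact ⟨w, fun hwR => hx (hclosed w hwR x hw.symm), hw⟩
  have hfour : ∀ c ∈ R, #(G.nbr univ c) = 4 := by
    intro c hc
    by_contra h
    have h3 := hG.three_le c
    have h4 := hG.card_le_four c
    obtain ⟨a, b, e, ha, hb, he, hab, hae, hbe⟩ :=
      hG.exists_claw_of_card_eq_three (c := c) (by omega)
    exact hclaw c hc a b e ha hb he hab hae hbe
  have hu4 := hfour u (hNR u huN)
  have hv4 := hfour v (hNR v hvN)
  have hy4 := hfour y (mem_insert_self _ _)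
  -- Since pq has at most one common neighbour, p has two neighbours a, b outside the closed
  -- neighbourhood of q. If both are adjacent to y, then either a, b are adjacent with common
  -- neighbours p and y, or p, q, a, b form a claw.
  have hmiss : ∀ p q, G.Adj p q → p ∈ R → ¬ G.Adj y p → p ≠ y →
      ∃ e, G.Adj p e ∧ e ≠ q ∧ ¬ G.Adj q e ∧ ¬ G.Adj y e := by
    intro p q hpq hp hyp hpy
    by_contra! hc
    have h1 := card_sdiff_add_card_inter (G.nbr univ p) (insert q (G.nbr univ q))
    have h2 : G.nbr univ p ∩ insert q (G.nbr univ q) ⊆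
        insert q (G.nbr univ p ∩ G.nbr univ q) := by
      intro x hx
      simp only [mem_inter, mem_insert] at hx ⊢
      tauto
    have h3 := (card_le_card h2).trans (card_insert_le _ _)
    have h4 := hG.card_inter_le_one hpq
    rw [hfour p hp] at h1
    obtain ⟨a, ha, b, hb, hab⟩ := one_lt_card.1
      (show 1 < #(G.nbr univ p \ insert q (G.nbr univ q)) by omega)
    simp only [mem_sdiff, mem_nbr, mem_univ, true_and, mem_insert, not_or] at ha hb
    have hya := hc a ha.1 ha.2.1 ha.2.2
    have hyb := hc b hb.1 hb.2.1 hb.2.2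
    by_cases habj : G.Adj a b
    · have h5 := hG.card_inter_le_one habj
      have h6 : ({p, y} : Finset V) ⊆ G.nbr univ a ∩ G.nbr univ b := by
        simp [insert_subset_iff, ha.1.symm, hb.1.symm, hya.symm, hyb.symm]
      have h7 := card_le_card h6
      rw [card_pair hpy] at h7
      omega
    · exact hclaw p hp q a b hpq ha.1 hb.1 ⟨fun h => ha.2.1 h.symm, ha.2.2⟩
        ⟨fun h => hb.2.1 h.symm, hb.2.2⟩ ⟨hab, habj⟩
  have hyu' : u ≠ y := by rintro rfl; exact hy.1 huN
  have hyv' : v ≠ y := by rintro rfl; exact hy.1 hvN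
  obtain ⟨p, hup, hpv, hvp, hyp⟩ := hmiss u v huv (hNR u huN) hyu hyu'
  obtain ⟨q, hvq, hqu, huq, hyq⟩ := hmiss v u huv.symm (hNR v hvN) hyv hyv'
  have h1 : G.nbr univ y ∪ {u, v, p, q} ⊆ G.pairNbr u v := by
    intro w hw
    simp only [mem_union, mem_nbr, mem_univ, true_and, mem_insert, mem_singleton] at hw
    rcases hw with hw | rfl | rfl | rfl | rfl
    exacts [hy.2 w hw, huN, hvN, mem_pairNbr.2 (Or.inl hup), mem_pairNbr.2 (Or.inr hvq)]
  have h2 := card_le_card h1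
  have hpq : p ≠ q := by rintro rfl; exact hvp hvq
  rw [card_union_of_disjoint, card_insert_of_notMem, card_insert_of_notMem, card_pair hpq, hy4,
    h7] at h2
  · omega
  · simp only [mem_insert, mem_singleton, not_or]; exact ⟨hpv.symm, hvq.ne⟩
  · simp only [mem_insert, mem_singleton, not_or]; exact ⟨huv.ne, hup.ne, hqu.symm⟩
  · rw [Finset.disjoint_left]
    intro z hz hz'
    simp only [mem_nbr, mem_univ, true_and, mem_insert, mem_singleton] at hz hz'
    rcases hz' with rfl | rfl | rfl | rfl
    exacts [hyu hz, hyv hz, hyp hz, hyq hz]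

end IsMinimalCounterexample

lemma not_isMinimalCounterexample (G : SimpleGraph V) : ¬ G.IsMinimalCounterexample := by
  intro hG
  have key : ∀ u v, G.Adj u v → #(G.nbr univ u) = 4 ∧ #(G.nbr univ u ∩ G.nbr univ v) = 0 := by
    intro u v huv
    have h1 := hG.eight_le huv
    have h2 := IsMinimalCounterexample.card_pairNbr_add (G := G) u v
    have h3 := hG.card_le_four u
    have h4 := hG.card_le_four v
    omega
  obtain ⟨S, hS, hc⟩ := exists_oddOn_of_regular_of_triangleFree (G := G)
    (fun v => by obtain ⟨w, hw⟩ := hG.exists_adj v; exact (key v w hw).1)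
    (fun a b c hab hbc hac => by
      have := (key a b hab).2
      rw [card_eq_zero, eq_empty_iff_forall_notMem] at this
      exact this c (by simp [hac, hbc]))
  have := hG.lt S hS
  omega

end SimpleGraph

/-! ### Transfer to induced subgraphs, and sharpness on seven vertices -/

namespace SimpleGraph

variable {V : Type u} {G : SimpleGraph V}

lemma card_nbr_map {W : Type*} {H : SimpleGraph W} (f : H ↪g G) (S : Finset W) (w : W) :
    #(G.nbr (S.map f.toEmbedding) (f w)) = #(H.nbr S w) := by
  rw [← card_map f.toEmbedding]
  congr 1
  ext x
  simp only [mem_nbr, mem_map]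
  constructor
  · rintro ⟨⟨y, hy, rfl⟩, h⟩
    exact ⟨y, ⟨hy, f.map_adj_iff.1 h⟩, rfl⟩
  · rintro ⟨y, ⟨hy, h⟩, rfl⟩
    exact ⟨⟨y, hy, rfl⟩, f.map_adj_iff.2 h⟩

lemma oddOn_map_iff {W : Type*} {H : SimpleGraph W} (f : H ↪g G) {S : Finset W} :
    G.OddOn (S.map f.toEmbedding) ↔ H.OddOn S := by
  simp only [OddOn, forall_mem_map]
  exact forall₂_congr fun w _ => by rw [← card_nbr_map f S w]; rfl

lemma degree_eq_card_nbr [Fintype V] (v : V) [Fintype (G.neighborSet v)] :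
    G.degree v = #(G.nbr univ v) := by
  rw [← card_neighborFinset_eq_degree]
  congr 1
  ext w
  simp

lemma isOdd_iff_oddOn_univ [Fintype V] : G.IsOdd ↔ G.OddOn univ := by
  simp only [IsOdd, OddOn, mem_univ, true_imp_iff, degree_eq_card_nbr]

lemma inducesOdd_iff_oddOn {S : Finset V} : G.InducesOdd S ↔ G.OddOn S := by
  rw [InducesOdd, isOdd_iff_oddOn_univ, ← oddOn_map_iff (Embedding.induce _)]
  congr!
  ext x
  simp [Embedding.induce]

/-- By strong induction on the order, a failing graph would be a minimal counterexample; odd sets of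
its proper induced subgraphs are mapped back along the embedding. -/
lemma exists_oddOn_of_card_nbr_le_four (n : ℕ) : ∀ {V : Type u} [Fintype V] (G : SimpleGraph V),
    Fintype.card V = n → (∀ v, ∃ w, G.Adj v w) → (∀ v, #(G.nbr univ v) ≤ 4) →
      ∃ S, G.OddOn S ∧ 2 * Fintype.card V ≤ 7 * #S := by
  classical
  induction n using Nat.strong_induction_on with
  | _ n ih =>
    intro V _ G hn hadj h4
    by_contra! hlt
    refine not_isMinimalCounterexample G ⟨h4, hadj, hlt, fun W hW hiso => ?_⟩
    let f : G.induce {v | v ∈ W} ↪g G := Embedding.induce _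
    have hf : ∀ x : {v | v ∈ W}, f x = x := fun _ => rfl
    have hcard : Fintype.card {v | v ∈ W} = #W := by simp
    have hlt : #W < n := by
      rw [← hn, ← card_univ]; exact card_lt_card (ssubset_univ_iff.2 hW)
    obtain ⟨S, hS, hc⟩ := ih _ hlt (G.induce {v | v ∈ W}) hcard
      (fun v => by
        obtain ⟨w, hw, h⟩ := hiso v v.2
        exact ⟨⟨w, hw⟩, h⟩)
      (fun v => by
        rw [← card_nbr_map f]
        exact (card_le_card (nbr_mono (subset_univ _) _)).trans (h4 _))
    refine ⟨S.map f.toEmbedding, fun x hx => ?_, (oddOn_map_iff f).2 hS, ?_⟩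
    · obtain ⟨y, -, rfl⟩ := mem_map.1 hx
      exact y.2
    · rwa [card_map, ← hcard]

lemma exists_oddOn_of_maxDegree_le_four [Fintype V] (G : SimpleGraph V) [DecidableRel G.Adj]
    (hiso : ∀ v, ¬ G.IsIsolated v) (hmax : G.maxDegree ≤ 4) :
    ∃ S, G.OddOn S ∧ 2 * Fintype.card V ≤ 7 * #S :=
  exists_oddOn_of_card_nbr_le_four _ G rfl (fun v => by simpa [IsIsolated] using hiso v)
    fun v => by rw [← degree_eq_card_nbr]; exact (G.degree_le_maxDegree v).trans hmax

/-- The complement of the cycle of length seven. -/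
abbrev coCycleSeven : SimpleGraph (Fin 7) := (cycleGraph 7)ᶜ

lemma exists_coCycleSeven_adj (v : Fin 7) : ∃ w, coCycleSeven.Adj v w := by
  revert v; decide

lemma degree_coCycleSeven (v : Fin 7) : coCycleSeven.degree v = 4 := by
  revert v; decide

lemma nbr_eq_filter (G : SimpleGraph V) [DecidableRel G.Adj] (S : Finset V) (v : V) :
    G.nbr S v = {w ∈ S | G.Adj v w} := by
  ext; simp

lemma card_le_two_of_oddOn_coCycleSeven {S : Finset (Fin 7)} (hS : coCycleSeven.OddOn S) :
    #S ≤ 2 := by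
  simp only [OddOn, nbr_eq_filter] at hS
  revert S
  set_option maxRecDepth 100000 in decide

lemma isGreatest_coCycleSeven {G : SimpleGraph (Fin 7)} (e : coCycleSeven ≃g G) :
    IsGreatest {k : ℕ | ∃ S : Finset (Fin 7), G.InducesOdd S ∧ #S = k} 2 := by
  constructor
  · refine ⟨({0, 2} : Finset (Fin 7)).map e.toEmbedding.toEmbedding, ?_, by rw [card_map]; rfl⟩
    rw [inducesOdd_iff_oddOn, oddOn_map_iff]
    simp only [OddOn, nbr_eq_filter]
    decide
  · rintro _ ⟨S, hS, rfl⟩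
    rw [← card_map e.symm.toEmbedding.toEmbedding]
    exact card_le_two_of_oddOn_coCycleSeven
      ((oddOn_map_iff e.symm.toEmbedding).2 (inducesOdd_iff_oddOn.1 hS))

namespace Walk

/-- Deleting the edges of a Hamiltonian cycle from the complete graph on seven vertices leaves the
complement of a cycle. -/
lemma IsHamiltonianCycle.nonempty_iso_coCycleSeven {a : Fin 7}
    {C : (completeGraph (Fin 7)).Walk a a} (hC : C.IsHamiltonianCycle) :
    Nonempty (coCycleSeven ≃g (completeGraph (Fin 7)).deleteEdges C.edgeSet) := by
  have hl : C.length = 7 := hC.length_eq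
  have hinj : Function.Injective fun i : Fin 7 => C.getVert i := fun i j hij =>
    Fin.ext (hC.isCycle.getVert_injOn' (by simp; omega) (by simp; omega) hij)
  -- At i = 6 the sum wraps to 0 in `Fin 7`, while position 7 of the walk is its closing vertex,
  -- equal to position 0.
  have hsucc : ∀ i : Fin 7, C.getVert (i + 1 : Fin 7) = C.getVert (i + 1 : ℕ) := by
    intro i
    by_cases h : i = 6
    · subst h
      have := C.getVert_length
      rw [hl] at this
      simpa using this.symm
    · congr 1
      revert i; decide
  have hedge : ∀ i j : Fin 7, s(C.getVert i, C.getVert j) ∈ C.edges ↔ i - j = 1 ∨ j - i = 1 := by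
    intro i j
    rw [mk_mem_edges_iff_exists, hl, sub_eq_iff_eq_add', sub_eq_iff_eq_add', or_comm]
    simp only [Sym2.eq_iff]
    constructor
    · rintro ⟨k, hk, h⟩
      have hs := hsucc ⟨k, hk⟩
      rw [← hs] at h
      exact h.imp (fun h => by rw [← hinj h.2, ← hinj (a₁ := ⟨k, hk⟩) h.1, add_comm])
        (fun h => by rw [← hinj h.2, ← hinj (a₁ := ⟨k, hk⟩) h.1, add_comm])
    · rintro (rfl | rfl)
      · exact ⟨i, i.2, Or.inl ⟨rfl, by rw [← hsucc]⟩⟩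
      · exact ⟨j, j.2, Or.inr ⟨rfl, by rw [← hsucc]⟩⟩
  -- Numbering the vertices along the cycle turns its edges into the pairs of cyclically consecutive
  -- indices.
  refine ⟨⟨Equiv.ofBijective _ (Finite.injective_iff_bijective.1 hinj), ?_⟩⟩
  intro i j
  simp only [Equiv.ofBijective_apply, deleteEdges_adj, completeGraph, top_adj, mem_edgeSet, hedge,
    hinj.ne_iff, compl_adj, cycleGraph_adj]

end Walk

end SimpleGraph

open SimpleGraph in
theorem theorem1 :
    -- every graph of order n, without isolated vertices and of maximum degree at most 4,
    -- has an odd induced subgraph of order at least 2n/7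
    (∀ (V : Type u) [Fintype V] (G : SimpleGraph V) [DecidableRel G.Adj],
      (∀ v, ¬ G.IsIsolated v) → G.maxDegree ≤ 4 →
        ∃ S : Finset V, G.InducesOdd S ∧ (2 / 7 : ℝ) * (Fintype.card V : ℝ) ≤ (S.card : ℝ)) ∧
    -- the constant 2/7 cannot be replaced by a larger one
    (∀ c : ℝ,
      (∀ (V : Type) [Fintype V] (G : SimpleGraph V) [DecidableRel G.Adj],
        (∀ v, ¬ G.IsIsolated v) → G.maxDegree ≤ 4 →
          ∃ S : Finset V, G.InducesOdd S ∧ c * (Fintype.card V : ℝ) ≤ (S.card : ℝ)) →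
      c ≤ 2 / 7) ∧
    -- K_7 minus a Hamiltonian cycle satisfies the hypotheses, and its largest odd induced
    -- subgraphs have exactly two vertices
    (∀ (a : Fin 7) (C : (SimpleGraph.completeGraph (Fin 7)).Walk a a), C.IsHamiltonianCycle →
      ∀ (G : SimpleGraph (Fin 7)) [DecidableRel G.Adj],
        G = (SimpleGraph.completeGraph (Fin 7)).deleteEdges C.edgeSet →
          (∀ v, ¬ G.IsIsolated v) ∧ G.maxDegree ≤ 4 ∧
          IsGreatest {k : ℕ | ∃ S : Finset (Fin 7), G.InducesOdd S ∧ S.card = k} 2) := by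
  refine ⟨fun V _ G _ hiso hmax => ?_, fun c hc => ?_, fun a C hC G _ hG => ?_⟩
  · obtain ⟨S, hS, h⟩ := G.exists_oddOn_of_maxDegree_le_four hiso hmax
    refine ⟨S, inducesOdd_iff_oddOn.2 hS, ?_⟩
    have : (2 : ℝ) * Fintype.card V ≤ 7 * #S := by exact_mod_cast h
    linarith
  · obtain ⟨S, hS, h⟩ := hc (Fin 7) coCycleSeven
      (fun v => by simpa [IsIsolated] using exists_coCycleSeven_adj v)
      (maxDegree_le_of_forall_degree_le _ _ fun v => (degree_coCycleSeven v).le)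
    have h2 : (#S : ℝ) ≤ 2 := by
      exact_mod_cast card_le_two_of_oddOn_coCycleSeven (inducesOdd_iff_oddOn.1 hS)
    rw [Fintype.card_fin] at h
    push_cast at h
    linarith
  · obtain ⟨e⟩ := hC.nonempty_iso_coCycleSeven
    rw [← hG] at e
    refine ⟨fun v hv => ?_, maxDegree_le_of_forall_degree_le _ _ fun v => ?_,
      isGreatest_coCycleSeven e⟩
    · obtain ⟨w, hw⟩ := exists_coCycleSeven_adj (e.symm v)
      exact hv (e w) (by simpa using e.map_adj_iff.2 hw)
    · rw [← e.symm.degree_eq, degree_coCycleSeven]
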